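/- **Theorem (Bi-Uniform Characterization of the Cantor bi-Cube).** Conventions. For a map $f:X\to Y$ between metric spaces let $\omega_f(\delta)=\sup\{d(f(x),f(x')):x,x'\in X,\ d(x,x')\le\delta\}\in[0,\infty]$. The map $f$ is *bi-uniform* if for every $\varepsilon>0$ there is $\delta>0$ with $\omega_f(\delta)\le\varepsilon$, and for every $\delta<\infty$ there is $\varepsilon<\infty$ with $\omega_f(\delta)\le\varepsilon$. Two metric spaces are *bi-uniformly equivalent* if there is a bijection $f$ between them such that $f$ and $f^{-1}$ are bi-uniform. The *Cantor bi-cube* is the set $2^{<\mathbb Z}=\{(x_i)_{i\in\mathbb Z}\in\{0,1\}^{\mathbb Z}:\exists n\in\mathbb N\ \forall i>n\ (x_i=0)\}$ with the ultrametric $d((x_i),(y_i))=\max_{i\in\mathbb Z}2^i|x_i-y_i|$. For a point $x$ of a metric space $X$ and $s>0$ let $C_s(x)$ be the set of all $y\in X$ for which there is a finite chain $y=z_0,z_1,\dots,z_n=x$ in $X$ with $d(z_{i-1},z_i)\le s$ for $1\le i\le n$, and let $\mathrm{mesh}_s(X)=\sup_{x\in X}\mathrm{diam}\,C_s(x)\in[0,\infty]$.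 The space $X$ has *bi-uniform dimension zero* if for every $\varepsilon>0$ there is $\delta>0$ with $\mathrm{mesh}_\delta(X)\le\varepsilon$, and for every $0<\delta<\infty$ there is $\varepsilon<\infty$ with $\mathrm{mesh}_\delta(X)\le\varepsilon$. For $0<\delta\le\varepsilon<\infty$ put $$\theta^\varepsilon_\delta(X)=\min_{x\in X}\bigl|\{C_\delta(y):y\in C_\varepsilon(x)\}\bigr|,\qquad \Theta^\varepsilon_\delta(X)=\sup_{x\in X}\bigl|\{C_\delta(y):y\in C_\varepsilon(x)\}\bigr|,$$ where all infinite cardinalities are regarded as $\infty$. Claim. A nonempty metric space $X$ is bi-uniformly equivalent to the Cantor bi-cube $2^{<\mathbb Z}$ if and only if the following four conditions hold: 1. $X$ is complete and has bi-uniform dimension zero; 2. $\Theta^\varepsilon_\delta(X)$ is finite for all $0<\delta\le\varepsilon<\infty$; 3. $\lim_{\varepsilon\to\infty}\theta^\varepsilon_\delta(X)=\infty$ for every $0<\delta<\infty$; 4. $\lim_{\delta\to+0}\theta^\varepsilon_\delta(X)=\infty$ for every $0<\varepsilon<\infty$. -/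

import Mathlib

open Filter Topology
open scoped ENNReal NNReal

namespace BiCube

/-! ### Oscillation and bi-uniform equivalences -/

section Maps

/-- The oscillation `ω_f(δ) = sup {dist (f x) (f x') : dist x x' ≤ δ}`, with values in `[0, ∞]`. -/
noncomputable def oscillation {X Y : Type*} [MetricSpace X] [MetricSpace Y] (f : X → Y)
    (δ : ℝ) : ℝ≥0∞ :=
  ⨆ (x : X) (x' : X) (_ : dist x x' ≤ δ), edist (f x) (f x')

/-- Micro-uniform (that is, uniformly continuous) maps. -/
def MicroUniform {X Y : Type*} [MetricSpace X] [MetricSpace Y] (f : X → Y) : Prop :=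
  ∀ ε : ℝ, 0 < ε → ∃ δ : ℝ, 0 < δ ∧ oscillation f δ ≤ ENNReal.ofReal ε

/-- Macro-uniform maps. -/
def MacroUniform {X Y : Type*} [MetricSpace X] [MetricSpace Y] (f : X → Y) : Prop :=
  ∀ δ : ℝ, 0 ≤ δ → ∃ ε : ℝ, 0 ≤ ε ∧ oscillation f δ ≤ ENNReal.ofReal ε

/-- Bi-uniform maps. -/
def BiUniform {X Y : Type*} [MetricSpace X] [MetricSpace Y] (f : X → Y) : Prop :=
  MicroUniform f ∧ MacroUniform f

/-- Two metric spaces are bi-uniformly equivalent if there is a bijection between them that is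
bi-uniform together with its inverse. -/
def BiUniformlyEquivalent (X Y : Type*) [MetricSpace X] [MetricSpace Y] : Prop :=
  ∃ f : X ≃ Y, BiUniform f ∧ BiUniform f.symm

end Maps

/-! ### Components at a given scale, dimension zero, counting of components -/

section Components

/-- The `s`-connected component `C_s(x)`: all points that are linked with `x` by a finite chain
of points with consecutive distances at most `s`. -/
def component {X : Type*} [MetricSpace X] (s : ℝ) (x : X) : Set X :=
  {y | Relation.ReflTransGen (fun a b : X => dist a b ≤ s) y x}

/-- The family of all `s`-connected components of `X`. -/
def components (X : Type*) [MetricSpace X] (s : ℝ) : Set (Set X) :=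
  Set.range (component s)

/-- The supremum of the diameters of the members of a family of sets, with values in `[0, ∞]`. -/
noncomputable def mesh {X : Type*} [MetricSpace X] (𝒞 : Set (Set X)) : ℝ≥0∞ :=
  ⨆ C ∈ 𝒞, Metric.ediam C

/-- Micro-uniform dimension zero. -/
def MicroUniformDimZero (X : Type*) [MetricSpace X] : Prop :=
  ∀ ε : ℝ, 0 < ε → ∃ δ : ℝ, 0 < δ ∧ mesh (components X δ) ≤ ENNReal.ofReal ε

/-- Macro-uniform (asymptotic) dimension zero. -/
def MacroUniformDimZero (X : Type*) [MetricSpace X] : Prop :=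
  ∀ δ : ℝ, 0 < δ → ∃ ε : ℝ, 0 < ε ∧ mesh (components X δ) ≤ ENNReal.ofReal ε

/-- Bi-uniform dimension zero. -/
def BiUniformDimZero (X : Type*) [MetricSpace X] : Prop :=
  MicroUniformDimZero X ∧ MacroUniformDimZero X

/-- The number `|C_ε(x)/𝒞_δ(X)|` of `δ`-connected components of points of `C_ε(x)`, as an
extended natural number: all infinite cardinals are identified with `⊤`. -/
noncomputable def componentCount {X : Type*} [MetricSpace X] (δ ε : ℝ) (x : X) : ℕ∞ :=
  (component δ '' component ε x).encard

/-- `θ_δ^ε(X)`. The infimum is a minimum, since `ℕ∞` is well-ordered and `X` is nonempty. -/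
noncomputable def lowerTheta (X : Type*) [MetricSpace X] [Nonempty X] (δ ε : ℝ) : ℕ∞ :=
  ⨅ x : X, componentCount δ ε x

/-- `Θ_δ^ε(X)`. -/
noncomputable def upperTheta (X : Type*) [MetricSpace X] (δ ε : ℝ) : ℕ∞ :=
  ⨆ x : X, componentCount δ ε x

end Components

/-! ### The Cantor bi-cube -/

/-- The Cantor bi-cube `2^{<ℤ}`: two-sided 0-1 sequences that vanish at all large indices. -/
def CantorBiCube : Type :=
  {x : ℤ → Fin 2 // ∃ n : ℕ, ∀ i : ℤ, (n : ℤ) < i → x i = 0}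

namespace CantorBiCube

/-- The number `2^i * |x_i - y_i|`. -/
noncomputable def term (x y : CantorBiCube) (i : ℤ) : ℝ :=
  (2 : ℝ) ^ i * |((x.1 i : ℕ) : ℝ) - ((y.1 i : ℕ) : ℝ)|

/-- The metric `d(x, y) = max_i 2^i * |x_i - y_i|`; `isGreatest_dist` below shows that the
supremum is attained. -/
noncomputable instance : Dist CantorBiCube :=
  ⟨fun x y => ⨆ i : ℤ, term x y i⟩

theorem dist_def (x y : CantorBiCube) : dist x y = ⨆ i : ℤ, term x y i := rfl

theorem term_nonneg (x y : CantorBiCube) (i : ℤ) : 0 ≤ term x y i := by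
  unfold term; positivity

theorem term_eq_zero {x y : CantorBiCube} {i : ℤ} (h : x.1 i = y.1 i) : term x y i = 0 := by
  simp [term, h]

theorem term_of_ne {x y : CantorBiCube} {i : ℤ} (h : x.1 i ≠ y.1 i) :
    term x y i = (2 : ℝ) ^ i := by
  unfold term
  generalize x.1 i = a at *
  generalize y.1 i = b at *
  fin_cases a <;> fin_cases b <;> simp_all

theorem exists_max (x y : CantorBiCube) : ∃ i, ∀ j, term x y j ≤ term x y i := by
  by_cases h : ∃ i, x.1 i ≠ y.1 i
  · obtain ⟨n, hn⟩ := x.2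
    obtain ⟨m, hm⟩ := y.2
    have hb : ∃ b : ℤ, ∀ z : ℤ, x.1 z ≠ y.1 z → z ≤ b := by
      refine ⟨max n m, fun z hz => ?_⟩
      by_contra hlt
      exact hz ((hn z (by omega)).trans (hm z (by omega)).symm)
    obtain ⟨i, hi, hmax⟩ := Int.exists_greatest_of_bdd hb h
    refine ⟨i, fun j => ?_⟩
    by_cases hj : x.1 j = y.1 j
    · rw [term_eq_zero hj]; exact term_nonneg x y i
    · rw [term_of_ne hj, term_of_ne hi]
      exact zpow_le_zpow_right₀ (by norm_num) (hmax j hj)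
  · push Not at h
    exact ⟨0, fun j => by rw [term_eq_zero (h j), term_eq_zero (h 0)]⟩

theorem isGreatest_dist (x y : CantorBiCube) :
    IsGreatest (Set.range (term x y)) (dist x y) := by
  obtain ⟨i, hi⟩ := exists_max x y
  have hg : IsGreatest (Set.range (term x y)) (term x y i) :=
    ⟨⟨i, rfl⟩, by rintro _ ⟨j, rfl⟩; exact hi j⟩
  have : dist x y = term x y i := hg.csSup_eq
  rw [this]; exact hg

theorem term_le_dist (x y : CantorBiCube) (i : ℤ) : term x y i ≤ dist x y :=
  (isGreatest_dist x y).2 ⟨i, rfl⟩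

theorem dist_le_max (x y z : CantorBiCube) : dist x z ≤ max (dist x y) (dist y z) := by
  obtain ⟨i, hi⟩ := (isGreatest_dist x z).1
  rw [← hi]
  by_cases h : x.1 i = y.1 i
  · refine le_trans (le_of_eq ?_) ((term_le_dist y z i).trans (le_max_right _ _))
    simp [term, h]
  · refine le_trans ?_ ((term_le_dist x y i).trans (le_max_left _ _))
    by_cases h2 : x.1 i = z.1 i
    · rw [term_eq_zero h2]; exact term_nonneg _ _ _
    · rw [term_of_ne h, term_of_ne h2]

noncomputable instance : MetricSpace CantorBiCube where
  dist_self x := by simp [dist_def, term]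
  dist_comm x y := by simp only [dist_def, term, abs_sub_comm]
  dist_triangle x y z := (dist_le_max x y z).trans <| max_le_add_of_nonneg
    ((term_nonneg x y 0).trans (term_le_dist x y 0))
    ((term_nonneg y z 0).trans (term_le_dist y z 0))
  eq_of_dist_eq_zero {x y} h := by
    refine Subtype.ext (funext fun i => ?_)
    by_contra hne
    have h1 := term_le_dist x y i
    rw [h, term_of_ne hne] at h1
    exact absurd h1 (not_le.2 (by positivity))

end CantorBiCube

end BiCube

/-!
Both directions go through an elementary form `IsBiCubeLike` of the four conditions. It is
inherited along bi-uniform equivalences (`IsBiCubeLike.of_equiv`) and holds in the bi-cube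
(`CantorBiCube.isBiCubeLike`), where components are balls and digits can be counted. The converse
is the symmetric statement that any two nonempty spaces `X` and `Y` with these properties are
bi-uniformly equivalent (`IsBiCubeLike.biUniformlyEquivalent`).

Scales `a n` in `X` and `b n` in `Y`, `n : ℤ`, are chosen so that the component towers of the two
spaces are interleaved (`exists_interleaved`): a component of one tower has many more pieces than
the next smaller one in the other tower can have. The towers are then matched level by level. At
level `n` both spaces are partitioned, with a bijection between the two partitions, in such a way
that the parts of `X` are components at scale `a n`, and the parts of `Y` are unions of components
at scale `b n` that lie in one component at scale `b (n + 1)`. For the passage to level `n - 1`,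
the small components in the `X`-part of a pair are distributed over the components in its
`Y`-part, and then the roles of the two spaces are exchanged (`exists_matching_of_weights`).

At negative levels it is enough that no part is left empty. At the levels `n ≥ 0` the ratios of
largest to smallest component size need not be bounded in `n`, so one has to keep track of sizes:
the weight of a set is the number of components at scale `1` in it, and matched parts have weights
that agree up to the factor `1 + 2⁻ⁿ`. A greedy distribution (`exists_balanced_assignment`)
changes the ratio of weights by less than the room left by these factors.

This construction runs downwards from some level `N` on bounded parts of the spaces. Its bounds do
not depend on `N`, and a base pair `(x₀, y₀)` stays matched at all levels. Hence the partners of a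
given point are confined to finitely many components, and the matchings below the levels `N` have
a limit along an ultrafilter (`Interleaved.exists_relation`). By completeness the limit relations
intersect to the graph of a bijection. It is bi-uniform in both directions, since for every `n` it
maps components at scale `a n` into components at scale `b (n + 1)`, and its inverse maps
components at scale `b n` into components at scale `a (n + 1)`.
-/

namespace BiCube

/-! ### Balanced assignments of items to bins -/

section Assignment

variable {ι κ α β : Type*}

/-- Adding items one by one, the total weight grows in steps of at most `m`, so every window of
length `m` below the full weight is hit. -/
theorem exists_subset_sum_mem_window (s : Finset ι) (v : ι → ℝ) {m c : ℝ}
    (hv : ∀ i ∈ s, v i ≤ m) (hc0 : 0 ≤ c + m) (hc : c ≤ ∑ i ∈ s, v i) :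
    ∃ S ⊆ s, c ≤ ∑ i ∈ S, v i ∧ ∑ i ∈ S, v i ≤ c + m := by
  classical
  induction s using Finset.induction_on with
  | empty => exact ⟨∅, subset_rfl, hc, by simpa using hc0⟩
  | insert a s ha ih =>
    by_cases h : c ≤ ∑ i ∈ s, v i
    · obtain ⟨S, hS, h1, h2⟩ := ih (fun i hi => hv i (Finset.mem_insert_of_mem hi)) h
      exact ⟨S, hS.trans (Finset.subset_insert _ _), h1, h2⟩
    · refine ⟨insert a s, subset_rfl, hc, ?_⟩
      rw [Finset.sum_insert ha]
      have := hv a (Finset.mem_insert_self _ _)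
      linarith

/-- Greedy filling of the bins of `t` with the items of `s`. The number `d` is the deficiency of
the total weight that earlier bins leave behind; keeping it in `[0, m]` prevents the errors from
accumulating. -/
theorem exists_assignment_of_deficiency [DecidableEq κ] (t : Finset κ) (ht : t.Nonempty)
    (T : κ → ℝ) (hT : ∀ l ∈ t, 0 ≤ T l) (v : ι → ℝ) {m : ℝ} (hm : 0 ≤ m) :
    ∀ (s : Finset ι) (d : ℝ), (∀ i ∈ s, v i ≤ m) → 0 ≤ d → d ≤ m →
      ∑ l ∈ t, T l - ∑ i ∈ s, v i = d →
      ∃ g : ι → κ, (∀ i ∈ s, g i ∈ t) ∧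
        ∀ l ∈ t, |∑ i ∈ s with g i = l, v i - T l| ≤ m := by
  classical
  induction ht using Finset.Nonempty.cons_induction with
  | singleton l =>
    intro s d hv hd0 hdm hd
    refine ⟨fun _ => l, fun _ _ => Finset.mem_singleton_self l, fun l' hl' => ?_⟩
    obtain rfl := Finset.mem_singleton.1 hl'
    rw [Finset.sum_singleton] at hd
    rw [Finset.filter_true_of_mem (fun _ _ => rfl), abs_le]
    constructor <;> linarith
  | cons l t hl ht ih =>
    intro s d hv hd0 hdm hd
    rw [Finset.sum_cons] at hd
    have hTl : 0 ≤ T l := hT l (Finset.mem_cons_self _ _)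
    have hTt : 0 ≤ ∑ k ∈ t, T k := Finset.sum_nonneg fun k hk => hT k (Finset.mem_cons_of_mem hk)
    obtain ⟨S, hS, h1, h2⟩ := exists_subset_sum_mem_window s v (c := T l - d) hv
      (by linarith) (by linarith)
    have hsum := Finset.sum_sdiff (f := v) hS
    obtain ⟨g, hg, hload⟩ := ih (fun k hk => hT k (Finset.mem_cons_of_mem hk)) (s \ S)
      (d - T l + ∑ i ∈ S, v i) (fun i hi => hv i (Finset.sdiff_subset hi)) (by linarith)
      (by linarith) (by linarith)
    refine ⟨fun i => if i ∈ S then l else g i, fun i hi => ?_, fun k hk => ?_⟩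
    · by_cases hiS : i ∈ S
      · simp [hiS]
      · simp only [hiS, if_false]
        exact Finset.mem_cons_of_mem (hg i (Finset.mem_sdiff.2 ⟨hi, hiS⟩))
    · rcases Finset.mem_cons.1 hk with rfl | hkt
      · have : (s.filter fun i => (if i ∈ S then k else g i) = k) = S := by
          ext i
          simp only [Finset.mem_filter]
          constructor
          · rintro ⟨hi, h⟩
            by_contra hiS
            rw [if_neg hiS] at h
            exact hl (h ▸ hg i (Finset.mem_sdiff.2 ⟨hi, hiS⟩))
          · intro hi
            exact ⟨hS hi, if_pos hi⟩
        rw [this, abs_le]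
        constructor <;> linarith
      · have hkl : l ≠ k := fun h => hl (h ▸ hkt)
        have : (s.filter fun i => (if i ∈ S then l else g i) = k)
            = (s \ S).filter fun i => g i = k := by
          ext i
          by_cases hiS : i ∈ S <;> simp [hiS, hkl]
        rw [this]
        exact hload k hkt

/-- Balanced assignment with one prescribed value. The items are the `π`-fibres of the finite set
`S`, the bins are the `ρ`-fibres of the finite set `T`, and both are weighted by their numbers of
points. Prescribing the bin of one item doubles the error `m` of the greedy assignment. -/
theorem exists_balanced_assignment [DecidableEq ι] [DecidableEq κ] (S : Finset α) (T : Finset β)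
    (π : α → ι) (ρ : β → κ) {m : ℝ} (hm : ∀ i, (((S.filter fun d => π d = i).card : ℕ) : ℝ) ≤ m)
    {i₀ : ι} {l₀ : κ} (hl₀ : l₀ ∈ T.image ρ) :
    ∃ g : ι → κ, (∀ d ∈ S, g (π d) ∈ T.image ρ) ∧ g i₀ = l₀ ∧
      ∀ l ∈ T.image ρ, |((S.filter fun d => g (π d) = l).card : ℝ) -
        (S.card : ℝ) / T.card * (T.filter fun e => ρ e = l).card| ≤ 2 * m := by
  classical
  have hm0 : 0 ≤ m := (Nat.cast_nonneg _).trans (hm i₀)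
  have hT0 : (T.card : ℝ) ≠ 0 := by
    obtain ⟨e, he, -⟩ := Finset.mem_image.1 hl₀
    exact_mod_cast (Finset.card_pos.2 ⟨e, he⟩).ne'
  set v : ι → ℝ := fun i => ((S.filter fun d => π d = i).card : ℝ) with hv
  set τ : ℝ := (S.card : ℝ) / T.card with hτ
  have hτ0 : 0 ≤ τ := by positivity
  have hsumT : ∑ l ∈ T.image ρ, τ * ((T.filter fun e => ρ e = l).card : ℝ) = S.card := by
    rw [← Finset.mul_sum, ← Nat.cast_sum,
      ← Finset.card_eq_sum_card_fiberwise (fun e he => Finset.mem_image_of_mem ρ he), hτ]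
    field_simp
  have hload : ∀ g : ι → κ, ∀ l, ((S.filter fun d => g (π d) = l).card : ℝ)
      = ∑ i ∈ S.image π with g i = l, v i := by
    intro g l
    rw [hv, ← Nat.cast_sum, Finset.card_eq_sum_card_fiberwise
      (t := (S.image π).filter fun i => g i = l) (f := π)]
    · refine congrArg _ (Finset.sum_congr rfl fun i hi => congrArg _ ?_)
      ext d
      simp only [Finset.mem_filter] at hi ⊢
      constructor
      · rintro ⟨⟨h1, -⟩, h2⟩; exact ⟨h1, h2⟩
      · rintro ⟨h1, h2⟩; exact ⟨⟨h1, h2 ▸ hi.2⟩, h2⟩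
    · intro d hd
      have hd' := Finset.mem_filter.1 hd
      exact Finset.mem_filter.2 ⟨Finset.mem_image_of_mem π hd'.1, hd'.2⟩
  have hsumS : ∑ i ∈ S.image π, v i = S.card := by
    rw [hv, ← Nat.cast_sum,
      ← Finset.card_eq_sum_card_fiberwise (fun e he => Finset.mem_image_of_mem π he)]
  obtain ⟨g, hg, hgl⟩ := exists_assignment_of_deficiency (T.image ρ) ⟨l₀, hl₀⟩
    (fun l => τ * ((T.filter fun e => ρ e = l).card : ℝ)) (fun l _ => by positivity) v hm0
    (S.image π) 0 (fun i _ => hm i) le_rfl hm0 (by rw [hsumT, hsumS, sub_self])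
  refine ⟨Function.update g i₀ l₀, fun d hd => ?_, Function.update_self _ _ _, fun l hl => ?_⟩
  · by_cases h : π d = i₀
    · rw [h, Function.update_self]; exact hl₀
    · rw [Function.update_of_ne h]; exact hg _ (Finset.mem_image_of_mem π hd)
  · have h1 := hgl l hl
    rw [← hload g l] at h1
    -- moving a single item changes a load by at most the weight of that item
    have h2 : ((S.filter fun d => Function.update g i₀ l₀ (π d) = l).card : ℝ) ≤
        (S.filter fun d => g (π d) = l).card + m := by
      refine le_trans ?_ (add_le_add_right (hm i₀) _)
      rw [← Nat.cast_add, Nat.cast_le]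
      refine le_trans (Finset.card_le_card fun d hd => ?_) (Finset.card_union_le _ _)
      have hd' := Finset.mem_filter.1 hd
      by_cases h : π d = i₀
      · exact Finset.mem_union_right _ (Finset.mem_filter.2 ⟨hd'.1, h⟩)
      · rw [Function.update_of_ne h] at hd'
        exact Finset.mem_union_left _ (Finset.mem_filter.2 hd')
    have h3 : ((S.filter fun d => g (π d) = l).card : ℝ) ≤
        (S.filter fun d => Function.update g i₀ l₀ (π d) = l).card + m := by
      refine le_trans ?_ (add_le_add_right (hm i₀) _)
      rw [← Nat.cast_add, Nat.cast_le]
      refine le_trans (Finset.card_le_card fun d hd => ?_) (Finset.card_union_le _ _)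
      have hd' := Finset.mem_filter.1 hd
      by_cases h : π d = i₀
      · exact Finset.mem_union_right _ (Finset.mem_filter.2 ⟨hd'.1, h⟩)
      · refine Finset.mem_union_left _ (Finset.mem_filter.2 ⟨hd'.1, ?_⟩)
        rw [Function.update_of_ne h]; exact hd'.2
    rw [abs_le] at h1 ⊢
    constructor <;> linarith [h1.1, h1.2]

end Assignment

/-! ### Matched partitions -/

section Matching

variable {X Y ι κ : Type*}

/-- A matched partition of `A` and `B`: a family of pairs of nonempty sets whose first components
partition `A`, whose second components partition `B`, and in which either component of a pair
determines the pair. -/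
structure IsMatching (𝒮 : Set (Set X × Set Y)) (A : Set X) (B : Set Y) : Prop where
  subset_left : ∀ p ∈ 𝒮, p.1 ⊆ A
  subset_right : ∀ p ∈ 𝒮, p.2 ⊆ B
  nonempty_left : ∀ p ∈ 𝒮, p.1.Nonempty
  nonempty_right : ∀ p ∈ 𝒮, p.2.Nonempty
  exists_left : ∀ x ∈ A, ∃ p ∈ 𝒮, x ∈ p.1
  exists_right : ∀ y ∈ B, ∃ p ∈ 𝒮, y ∈ p.2
  unique_left : ∀ p ∈ 𝒮, ∀ q ∈ 𝒮, ∀ x, x ∈ p.1 → x ∈ q.1 → p = q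
  unique_right : ∀ p ∈ 𝒮, ∀ q ∈ 𝒮, ∀ y, y ∈ p.2 → y ∈ q.2 → p = q

theorem IsMatching.singleton {A : Set X} {B : Set Y} (hA : A.Nonempty) (hB : B.Nonempty) :
    IsMatching {(A, B)} A B := by
  constructor <;> simp_all

theorem IsMatching.swap {𝒮 : Set (Set X × Set Y)} {A : Set X} {B : Set Y}
    (h : IsMatching 𝒮 A B) : IsMatching (Prod.swap ⁻¹' 𝒮) B A where
  subset_left p hp := h.subset_right _ hp
  subset_right p hp := h.subset_left _ hp
  nonempty_left p hp := h.nonempty_right _ hp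
  nonempty_right p hp := h.nonempty_left _ hp
  exists_left x hx := by
    obtain ⟨p, hp, hx⟩ := h.exists_right x hx
    exact ⟨p.swap, hp, hx⟩
  exists_right x hx := by
    obtain ⟨p, hp, hx⟩ := h.exists_left x hx
    exact ⟨p.swap, hp, hx⟩
  unique_left p hp q hq x hxp hxq :=
    Prod.swap_injective (h.unique_right _ hp _ hq x hxp hxq)
  unique_right p hp q hq x hxp hxq :=
    Prod.swap_injective (h.unique_left _ hp _ hq x hxp hxq)

/-- The family of pairs `𝒬` is a matched partition of `A` and `B` into pairs with the property
`G`, and the base points `x` and `y` lie in the two components of one and the same pair. -/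
def IsPointedMatching (G : Set X × Set Y → Prop) (𝒬 : Set (Set X × Set Y)) (A : Set X) (B : Set Y)
    (x : X) (y : Y) : Prop :=
  IsMatching 𝒬 A B ∧ (∃ q ∈ 𝒬, x ∈ q.1 ∧ y ∈ q.2) ∧ ∀ q ∈ 𝒬, G q

/-- Matched partitions of the pairs of a matched partition can be put together. -/
theorem IsPointedMatching.refine {G G' : Set X × Set Y → Prop} {𝒮 : Set (Set X × Set Y)}
    {A : Set X} {B : Set Y} {x : X} {y : Y} (h : IsPointedMatching G 𝒮 A B x y)
    (hG : ∀ p, G p → ∀ x ∈ p.1, ∀ y ∈ p.2, ∃ 𝒬, IsPointedMatching G' 𝒬 p.1 p.2 x y) :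
    ∃ 𝒬, IsPointedMatching G' 𝒬 A B x y ∧ ∀ q ∈ 𝒬, ∃ p ∈ 𝒮, q.1 ⊆ p.1 ∧ q.2 ⊆ p.2 := by
  classical
  obtain ⟨hm, ⟨p₀, hp₀, hx₀, hy₀⟩, hG𝒮⟩ := h
  have hex : ∀ p : Set X × Set Y, ∃ 𝒬, p ∈ 𝒮 →
      (IsMatching 𝒬 p.1 p.2 ∧ ∀ q ∈ 𝒬, G' q) ∧ (p = p₀ → ∃ q ∈ 𝒬, x ∈ q.1 ∧ y ∈ q.2) := by
    intro p
    by_cases hp : p ∈ 𝒮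
    · by_cases hpp : p = p₀
      · subst hpp
        obtain ⟨𝒬, h1, h2, h3⟩ := hG p (hG𝒮 p hp) x hx₀ y hy₀
        exact ⟨𝒬, fun _ => ⟨⟨h1, h3⟩, fun _ => h2⟩⟩
      · obtain ⟨x', hx'⟩ := hm.nonempty_left p hp
        obtain ⟨y', hy'⟩ := hm.nonempty_right p hp
        obtain ⟨𝒬, h1, h2, h3⟩ := hG p (hG𝒮 p hp) x' hx' y' hy'
        exact ⟨𝒬, fun _ => ⟨⟨h1, h3⟩, fun h => absurd h hpp⟩⟩
    · exact ⟨∅, fun h => absurd h hp⟩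
  choose f hf using hex
  have hf1 : ∀ p ∈ 𝒮, IsMatching (f p) p.1 p.2 := fun p hp => (hf p hp).1.1
  refine ⟨⋃ p ∈ 𝒮, f p, ⟨⟨?_, ?_, ?_, ?_, ?_, ?_, ?_, ?_⟩, ?_, ?_⟩, ?_⟩
  · intro q hq
    obtain ⟨p, hp, hq⟩ := Set.mem_iUnion₂.1 hq
    exact ((hf1 p hp).subset_left q hq).trans (hm.subset_left p hp)
  · intro q hq
    obtain ⟨p, hp, hq⟩ := Set.mem_iUnion₂.1 hq
    exact ((hf1 p hp).subset_right q hq).trans (hm.subset_right p hp)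
  · intro q hq
    obtain ⟨p, hp, hq⟩ := Set.mem_iUnion₂.1 hq
    exact (hf1 p hp).nonempty_left q hq
  · intro q hq
    obtain ⟨p, hp, hq⟩ := Set.mem_iUnion₂.1 hq
    exact (hf1 p hp).nonempty_right q hq
  · intro z hz
    obtain ⟨p, hp, hzp⟩ := hm.exists_left z hz
    obtain ⟨q, hq, hzq⟩ := (hf1 p hp).exists_left z hzp
    exact ⟨q, Set.mem_iUnion₂.2 ⟨p, hp, hq⟩, hzq⟩
  · intro z hz
    obtain ⟨p, hp, hzp⟩ := hm.exists_right z hz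
    obtain ⟨q, hq, hzq⟩ := (hf1 p hp).exists_right z hzp
    exact ⟨q, Set.mem_iUnion₂.2 ⟨p, hp, hq⟩, hzq⟩
  · intro q hq q' hq' z hz hz'
    obtain ⟨p, hp, hq⟩ := Set.mem_iUnion₂.1 hq
    obtain ⟨p', hp', hq'⟩ := Set.mem_iUnion₂.1 hq'
    obtain rfl := hm.unique_left p hp p' hp' z ((hf1 p hp).subset_left q hq hz)
      ((hf1 p' hp').subset_left q' hq' hz')
    exact (hf1 p hp).unique_left q hq q' hq' z hz hz'
  · intro q hq q' hq' z hz hz'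
    obtain ⟨p, hp, hq⟩ := Set.mem_iUnion₂.1 hq
    obtain ⟨p', hp', hq'⟩ := Set.mem_iUnion₂.1 hq'
    obtain rfl := hm.unique_right p hp p' hp' z ((hf1 p hp).subset_right q hq hz)
      ((hf1 p' hp').subset_right q' hq' hz')
    exact (hf1 p hp).unique_right q hq q' hq' z hz hz'
  · obtain ⟨q, hq, h⟩ := (hf p₀ hp₀).2 rfl
    exact ⟨q, Set.mem_iUnion₂.2 ⟨p₀, hp₀, hq⟩, h⟩
  · intro q hq
    obtain ⟨p, hp, hq⟩ := Set.mem_iUnion₂.1 hq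
    exact (hf p hp).1.2 q hq
  · intro q hq
    obtain ⟨p, hp, hq⟩ := Set.mem_iUnion₂.1 hq
    exact ⟨p, hp, (hf1 p hp).subset_left q hq, (hf1 p hp).subset_right q hq⟩

/-- `A` is a union of fibres of `π`. -/
def Saturated (π : X → ι) (A : Set X) : Prop :=
  ∀ x x', π x = π x' → x ∈ A → x' ∈ A

theorem saturated_fiber (π : X → ι) (i : ι) : Saturated π (π ⁻¹' {i}) := by
  rintro x x' h (rfl : π x = i)
  exact h.symm

/-- Distributing the `π`-fibres of `A` over the `σ`-fibres of `B`. The weight of a set is the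
number of its points in `D` (respectively `D'`), and every pair of the matched partition has
almost the same ratio of weights as the pair `(A, B)`. -/
theorem exists_matching_of_weights {π : X → ι} {σ : Y → κ} {A D : Set X} {B D' : Set Y}
    (hA : Saturated π A) (hB : Saturated σ B) (hD : ∀ x ∈ A, ∃ d ∈ D, π d = π x)
    (hD' : ∀ y ∈ B, ∃ d ∈ D', σ d = σ y) (hAf : (A ∩ D).Finite) (hBf : (B ∩ D').Finite) {m : ℝ}
    (hm : ∀ x ∈ A, ((π ⁻¹' {π x} ∩ D).ncard : ℝ) ≤ m) {x₀ : X} {y₀ : Y} (hx₀ : x₀ ∈ A)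
    (hy₀ : y₀ ∈ B) (hpos : ∀ y ∈ B,
      2 * m * (B ∩ D').ncard < (A ∩ D).ncard * (σ ⁻¹' {σ y} ∩ D').ncard) :
    ∃ 𝒮, IsPointedMatching (fun p => (∃ y ∈ B, p.2 = σ ⁻¹' {σ y}) ∧ p.1 ⊆ A ∧ p.1.Nonempty ∧
      Saturated π p.1 ∧ |((p.1 ∩ D).ncard : ℝ) -
        ((A ∩ D).ncard : ℝ) / (B ∩ D').ncard * (p.2 ∩ D').ncard| ≤ 2 * m) 𝒮 A B x₀ y₀ := by
  classical
  set S := hAf.toFinset with hS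
  set T := hBf.toFinset with hT
  have hScard : (A ∩ D).ncard = S.card := Set.ncard_eq_toFinset_card _ hAf
  have hTcard : (B ∩ D').ncard = T.card := Set.ncard_eq_toFinset_card _ hBf
  have hm0 : 0 ≤ m := (Nat.cast_nonneg _).trans (hm x₀ hx₀)
  have hmem : ∀ y ∈ B, σ y ∈ T.image σ := by
    intro y hy
    obtain ⟨d, hd, hdy⟩ := hD' y hy
    exact Finset.mem_image.2 ⟨d, by simpa [hT] using ⟨hB y d hdy.symm hy, hd⟩, hdy⟩
  obtain ⟨g, hg, hg₀, hload⟩ := exists_balanced_assignment S T π σ (m := m) (i₀ := π x₀)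
    (l₀ := σ y₀) (by
      intro i
      by_cases hi : (S.filter fun d => π d = i).Nonempty
      · obtain ⟨d, hd⟩ := hi
        obtain ⟨hdS, rfl⟩ := Finset.mem_filter.1 hd
        have hdA : d ∈ A := ((Set.Finite.mem_toFinset _).1 hdS).1
        refine le_trans ?_ (hm d hdA)
        rw [← Set.ncard_coe_finset, Nat.cast_le]
        refine Set.ncard_le_ncard ?_ (hAf.subset fun z hz => ⟨hA d z hz.1.symm hdA, hz.2⟩)
        intro z hz
        have hz' := Finset.mem_filter.1 (Finset.mem_coe.1 hz)
        exact ⟨hz'.2, ((Set.Finite.mem_toFinset _).1 hz'.1).2⟩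
      · rw [Finset.not_nonempty_iff_eq_empty.1 hi]
        simpa using hm0) (hmem y₀ hy₀)
  have hL : ∀ l, ({x | x ∈ A ∧ g (π x) = l} ∩ D).ncard
      = (S.filter fun d => g (π d) = l).card := by
    intro l
    rw [← Set.ncard_coe_finset]
    congr 1
    ext z
    simp only [Set.mem_inter_iff, Set.mem_ofPred_eq, hS, Finset.coe_filter,
      Set.Finite.mem_toFinset]
    tauto
  have hR : ∀ y ∈ B, (σ ⁻¹' {σ y} ∩ D').ncard = (T.filter fun e => σ e = σ y).card := by
    intro y hy
    rw [← Set.ncard_coe_finset]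
    congr 1
    ext z
    simp only [Set.mem_inter_iff, Set.mem_preimage, Set.mem_singleton_iff, hT,
      Finset.coe_filter, Set.Finite.mem_toFinset, Set.mem_ofPred_eq]
    constructor
    · rintro ⟨h1, h2⟩; exact ⟨⟨hB y z h1.symm hy, h2⟩, h1⟩
    · rintro ⟨⟨-, h2⟩, h1⟩; exact ⟨h1, h2⟩
  have hT0 : 0 < (T.card : ℝ) := by
    obtain ⟨e, he, -⟩ := Finset.mem_image.1 (hmem y₀ hy₀)
    exact_mod_cast Finset.card_pos.2 ⟨e, he⟩
  have hne : ∀ y ∈ B, {x | x ∈ A ∧ g (π x) = σ y}.Nonempty := by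
    intro y hy
    have h1 := hload (σ y) (hmem y hy)
    have h2 := hpos y hy
    rw [hR y hy, hScard, hTcard] at h2
    have h3 : 0 < ((S.filter fun d => g (π d) = σ y).card : ℝ) := by
      have h4 : 2 * m < (S.card : ℝ) / T.card * (T.filter fun e => σ e = σ y).card := by
        rw [div_mul_eq_mul_div, lt_div_iff₀ hT0]; exact h2
      linarith [(abs_le.1 h1).1]
    obtain ⟨d, hd⟩ := Finset.card_pos.1 (Nat.cast_pos.1 h3)
    obtain ⟨hdS, hdl⟩ := Finset.mem_filter.1 hd
    exact ⟨d, ((Set.Finite.mem_toFinset _).1 hdS).1, hdl⟩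
  have hgA : ∀ x ∈ A, ∃ y ∈ B, σ y = g (π x) := by
    intro x hx
    obtain ⟨d, hd, hdx⟩ := hD x hx
    have := hg d (by simpa [hS] using ⟨hA x d hdx.symm hx, hd⟩)
    obtain ⟨y, hy, hyl⟩ := Finset.mem_image.1 this
    exact ⟨y, ((Set.Finite.mem_toFinset _).1 hy).1, by rw [hyl, hdx]⟩
  refine ⟨{p | ∃ y ∈ B, p = ({x | x ∈ A ∧ g (π x) = σ y}, σ ⁻¹' {σ y})},
    ⟨?_, ?_, ?_, ?_, ?_, ?_, ?_, ?_⟩, ?_, ?_⟩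
  · rintro _ ⟨y, hy, rfl⟩ x hx
    exact hx.1
  · rintro _ ⟨y, hy, rfl⟩ y' hy'
    exact hB y y' (Eq.symm hy') hy
  · rintro _ ⟨y, hy, rfl⟩
    exact hne y hy
  · rintro _ ⟨y, hy, rfl⟩
    exact ⟨y, rfl⟩
  · intro x hx
    obtain ⟨y, hy, h⟩ := hgA x hx
    exact ⟨_, ⟨y, hy, rfl⟩, hx, h.symm⟩
  · intro y hy
    exact ⟨_, ⟨y, hy, rfl⟩, rfl⟩
  · rintro _ ⟨y, hy, rfl⟩ _ ⟨y', hy', rfl⟩ x hx hx'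
    have : σ y = σ y' := hx.2.symm.trans hx'.2
    simp only [this]
  · rintro _ ⟨y, hy, rfl⟩ _ ⟨y', hy', rfl⟩ z hz hz'
    have : σ y = σ y' := Eq.trans (Eq.symm hz) hz'
    simp only [this]
  · exact ⟨_, ⟨y₀, hy₀, rfl⟩, ⟨hx₀, hg₀⟩, rfl⟩
  · rintro _ ⟨y, hy, rfl⟩
    refine ⟨⟨y, hy, rfl⟩, fun x hx => hx.1, hne y hy, ?_, ?_⟩
    · rintro x x' h ⟨hx, hxl⟩
      exact ⟨hA x x' h hx, h ▸ hxl⟩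
    · simp only [hL, hR y hy, hScard, hTcard]
      exact hload (σ y) (hmem y hy)

end Matching

/-! ### Interleaved towers -/

section Towers

variable {X Y ι κ : Type*}

theorem IsPointedMatching.swap {G : Set X × Set Y → Prop} {𝒮 : Set (Set X × Set Y)} {A : Set X}
    {B : Set Y} {x : X} {y : Y} (h : IsPointedMatching G 𝒮 A B x y) :
    IsPointedMatching (fun p => G p.swap) (Prod.swap ⁻¹' 𝒮) B A y x := by
  obtain ⟨h1, ⟨q, hq, hx, hy⟩, h3⟩ := h
  exact ⟨h1.swap, ⟨q.swap, hq, hy, hx⟩, fun p hp => h3 _ hp⟩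

theorem IsPointedMatching.imp {G G' : Set X × Set Y → Prop} {𝒮 : Set (Set X × Set Y)} {A : Set X}
    {B : Set Y} {x : X} {y : Y} (h : IsPointedMatching G 𝒮 A B x y) (hG : ∀ p, G p → G' p) :
    IsPointedMatching G' 𝒮 A B x y :=
  ⟨h.1, h.2.1, fun q hq => hG q (h.2.2 q hq)⟩

theorem exists_transversal (π : X → ι) :
    ∃ D : Set X, Set.InjOn π D ∧ ∀ x, ∃ d ∈ D, π d = π x := by
  obtain ⟨D, -, hD⟩ := Set.exists_subset_bijOn Set.univ π
  refine ⟨D, hD.injOn, fun x => ?_⟩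
  obtain ⟨d, hd, h⟩ := hD.surjOn ⟨x, Set.mem_univ x, rfl⟩
  exact ⟨d, hd, h⟩

/-- The points of a transversal in a union of fibres correspond to these fibres. -/
theorem bijOn_transversal {π : X → ι} {D A : Set X} (hD : Set.InjOn π D)
    (hD' : ∀ x, ∃ d ∈ D, π d = π x) (hA : Saturated π A) : Set.BijOn π (A ∩ D) (π '' A) := by
  refine ⟨fun x hx => ⟨x, hx.1, rfl⟩, hD.mono Set.inter_subset_right, ?_⟩
  rintro _ ⟨x, hx, rfl⟩
  obtain ⟨d, hd, h⟩ := hD' x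
  exact ⟨d, ⟨hA x d h.symm hx, hd⟩, h⟩

theorem ncard_inter_transversal {π : X → ι} {D A : Set X} (hD : Set.InjOn π D)
    (hD' : ∀ x, ∃ d ∈ D, π d = π x) (hA : Saturated π A) :
    (A ∩ D).ncard = (π '' A).ncard := by
  have h := bijOn_transversal hD hD' hA
  rw [← h.image_eq, h.injOn.ncard_image]

/-- If `A` has at least three times as many `π`-fibres as `B` has `σ`-fibres, then the former can
be distributed over the latter so that none of the latter is left empty: when every fibre has weight
`1`, the loads differ from their average, which is at least `3`, by at most `2`. -/
theorem exists_matching_of_card {π : X → ι} {σ : Y → κ} {A : Set X} {B : Set Y}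
    (hA : Saturated π A) (hB : Saturated σ B) (hAf : (π '' A).Finite) (hBf : (σ '' B).Finite)
    {x₀ : X} {y₀ : Y} (hx₀ : x₀ ∈ A) (hy₀ : y₀ ∈ B) (h : 3 * (σ '' B).ncard ≤ (π '' A).ncard) :
    ∃ 𝒮, IsPointedMatching (fun p => (∃ y ∈ B, p.2 = σ ⁻¹' {σ y}) ∧ p.1 ⊆ A ∧ p.1.Nonempty ∧
      Saturated π p.1) 𝒮 A B x₀ y₀ := by
  obtain ⟨D, hD, hDm⟩ := exists_transversal π
  obtain ⟨D', hD', hDm'⟩ := exists_transversal σ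
  have hone : ∀ x, (π ⁻¹' {π x} ∩ D).ncard = 1 := by
    intro x
    rw [ncard_inter_transversal hD hDm (saturated_fiber _ _)]
    have : π '' (π ⁻¹' {π x}) = {π x} := by
      ext i; constructor
      · rintro ⟨z, hz, rfl⟩; exact hz
      · rintro rfl; exact ⟨x, rfl, rfl⟩
    rw [this, Set.ncard_singleton]
  have hone' : ∀ y, (σ ⁻¹' {σ y} ∩ D').ncard = 1 := by
    intro y
    rw [ncard_inter_transversal hD' hDm' (saturated_fiber _ _)]
    have : σ '' (σ ⁻¹' {σ y}) = {σ y} := by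
      ext i; constructor
      · rintro ⟨z, hz, rfl⟩; exact hz
      · rintro rfl; exact ⟨y, rfl, rfl⟩
    rw [this, Set.ncard_singleton]
  have hpos : 0 < (σ '' B).ncard := (Set.ncard_pos hBf).2 ⟨_, y₀, hy₀, rfl⟩
  obtain ⟨𝒮, h𝒮⟩ := exists_matching_of_weights (m := 1) hA hB (fun x _ => hDm x)
    (fun y _ => hDm' y)
    ((bijOn_transversal hD hDm hA).finite_iff_finite.2 hAf)
    ((bijOn_transversal hD' hDm' hB).finite_iff_finite.2 hBf)
    (fun x _ => by rw [hone x, Nat.cast_one]) hx₀ hy₀ (by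
      intro y _
      rw [hone' y, ncard_inter_transversal hD hDm hA, ncard_inter_transversal hD' hDm' hB]
      have : 2 * (σ '' B).ncard < (π '' A).ncard := by omega
      have : (2 * (σ '' B).ncard : ℝ) < (π '' A).ncard := by exact_mod_cast this
      simpa using this)
  exact ⟨𝒮, h𝒮.imp fun p hp => ⟨hp.1, hp.2.1, hp.2.2.1, hp.2.2.2.1⟩⟩

/-- Two towers of partitions of `X` and `Y`, given by the fibres of `π n` and `σ n` for `n : ℤ`,
whose sizes are interleaved. At the levels `n ≥ 0` sizes are measured by the numbers of points in
fixed discrete sets `D ⊆ X` and `D' ⊆ Y`, and the fibres of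
`σ 0, π 0, σ 1, π 1, …` are of rapidly increasing size: the factor `32 * 2 ^ n` makes the rounding
errors at level `n` small compared with `2⁻ⁿ`. At the negative levels the numbers of
pieces into which fibres are divided are compared instead. -/
structure Interleaved (π : ℤ → X → ι) (σ : ℤ → Y → κ) (D : Set X) (D' : Set Y)
    (u v : ℕ → ℕ) : Prop where
  mono_left : ∀ m n, m ≤ n → ∀ x x', π m x = π m x' → π n x = π n x'
  mono_right : ∀ m n, m ≤ n → ∀ y y', σ m y = σ m y' → σ n y = σ n y'
  exhaust_left : ∀ x x', ∃ n : ℕ, π n x = π n x'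
  exhaust_right : ∀ y y', ∃ n : ℕ, σ n y = σ n y'
  finite_left : ∀ m n x, (π m '' (π n ⁻¹' {π n x})).Finite
  finite_right : ∀ m n y, (σ m '' (σ n ⁻¹' {σ n y})).Finite
  meets_left : ∀ x, ∃ d ∈ D, π 0 d = π 0 x
  meets_right : ∀ y, ∃ d ∈ D', σ 0 d = σ 0 y
  finite_inter_left : ∀ (n : ℕ) x, (π n ⁻¹' {π n x} ∩ D).Finite
  finite_inter_right : ∀ (n : ℕ) y, (σ n ⁻¹' {σ n y} ∩ D').Finite
  ncard_le_left : ∀ (n : ℕ) x, (π n ⁻¹' {π n x} ∩ D).ncard ≤ u n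
  ncard_le_right : ∀ (n : ℕ) y, (σ n ⁻¹' {σ n y} ∩ D').ncard ≤ v n
  le_ncard_left : ∀ (n : ℕ) x, 32 * 2 ^ n * v n ≤ (π n ⁻¹' {π n x} ∩ D).ncard
  le_ncard_right : ∀ (n : ℕ) y,
    32 * 2 ^ n * u n ≤ (σ (n + 1 : ℕ) ⁻¹' {σ (n + 1 : ℕ) y} ∩ D').ncard
  micro_left : ∀ n : ℤ, n < 0 → ∀ x y, 3 * (σ (n + 1) '' (σ (n + 2) ⁻¹' {σ (n + 2) y})).ncard ≤
    (π n '' (π (n + 1) ⁻¹' {π (n + 1) x})).ncard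
  micro_right : ∀ n : ℤ, n < 0 → ∀ x y, 3 * (π n '' (π (n + 1) ⁻¹' {π (n + 1) x})).ncard ≤
    (σ n '' (σ (n + 1) ⁻¹' {σ (n + 1) y})).ncard

variable {π : ℤ → X → ι} {σ : ℤ → Y → κ} {D : Set X} {D' : Set Y} {u v : ℕ → ℕ}

/-- The pairs matched at level `n`: a fibre of `π n` and a union of fibres of `σ n` that lies in
one fibre of `σ (n + 1)`. For `n ≥ 0` the weights of both sets agree up to the factor
`1 + 2⁻ⁿ`; this factor increases as `n` decreases, which leaves room for rounding errors. -/
def IsGoodPair (π : ℤ → X → ι) (σ : ℤ → Y → κ) (D : Set X) (D' : Set Y) (n : ℤ)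
    (p : Set X × Set Y) : Prop :=
  (∃ x, p.1 = π n ⁻¹' {π n x}) ∧ Saturated (σ n) p.2 ∧ p.2.Nonempty ∧
    (∃ y, p.2 ⊆ σ (n + 1) ⁻¹' {σ (n + 1) y}) ∧
    ∀ k : ℕ, n = k → ((p.2 ∩ D').ncard : ℝ) ≤ (1 + (2⁻¹ : ℝ) ^ k) * (p.1 ∩ D).ncard ∧
      ((p.1 ∩ D).ncard : ℝ) ≤ (1 + (2⁻¹ : ℝ) ^ k) * (p.2 ∩ D').ncard

/-- If the weights `a` and `b` agree up to the factor `c`, then the weights `L` and `w` of a pair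
obtained by an almost proportional distribution agree up to a slightly larger factor. -/
theorem ratio_bounds {a b L w m c c' : ℝ} (ha : 0 < a) (hb : 0 < b) (hab : a ≤ c * b)
    (hba : b ≤ c * a) (hw : 0 < w) (hc : 1 ≤ c) (hcc : c ≤ c') (hc' : c' ≤ 2)
    (hm : 2 * m ≤ (c' - c) / 4 * w) (hL : |L - a / b * w| ≤ 2 * m) :
    L ≤ c' * w ∧ w ≤ c' * L := by
  have hτ1 : a / b ≤ c := by rwa [div_le_iff₀ hb]
  have hτ2 : 1 ≤ c * (a / b) := by rw [← mul_div_assoc, le_div_iff₀ hb]; linarith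
  have hτ0 : 0 < a / b := div_pos ha hb
  set τ := a / b
  obtain ⟨h1, h2⟩ := abs_le.1 hL
  have h3 : τ * w ≤ c * w := by gcongr
  have h4 : 0 ≤ (c' - c) * w := mul_nonneg (by linarith) hw.le
  refine ⟨by nlinarith, ?_⟩
  have h5 : 1 / 2 ≤ τ := by nlinarith
  have h6 : 1 + (c' - c) / 2 ≤ c' * τ := by nlinarith
  have h7 : (1 + (c' - c) / 2) * w ≤ c' * τ * w := by gcongr
  have h8 : c' * (2 * m) ≤ (c' - c) / 2 * w := by
    calc c' * (2 * m) ≤ c' * ((c' - c) / 4 * w) := by gcongr; linarith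
      _ ≤ 2 * ((c' - c) / 4 * w) := by gcongr
      _ = _ := by ring
  have h9 : c' * (τ * w - 2 * m) ≤ c' * L :=
    mul_le_mul_of_nonneg_left (by linarith) (by linarith)
  nlinarith

namespace Interleaved

variable (h : Interleaved π σ D D' u v)
include h

theorem saturated_left {m n : ℤ} (hmn : m ≤ n) (x : X) :
    Saturated (π m) (π n ⁻¹' {π n x}) :=
  fun z z' hz hzx => (h.mono_left m n hmn z z' hz).symm.trans hzx

theorem saturated_right {m n : ℤ} (hmn : m ≤ n) (y : Y) :
    Saturated (σ m) (σ n ⁻¹' {σ n y}) :=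
  fun z z' hz hzx => (h.mono_right m n hmn z z' hz).symm.trans hzx

theorem meets_left' (n : ℕ) (x : X) : ∃ d ∈ D, π n d = π n x := by
  obtain ⟨d, hd, hdx⟩ := h.meets_left x
  exact ⟨d, hd, h.mono_left 0 n (by positivity) _ _ hdx⟩

theorem meets_right' (n : ℕ) (y : Y) : ∃ d ∈ D', σ n d = σ n y := by
  obtain ⟨d, hd, hdx⟩ := h.meets_right y
  exact ⟨d, hd, h.mono_right 0 n (by positivity) _ _ hdx⟩

theorem ncard_pos_left (n : ℕ) (x : X) : 0 < (π n ⁻¹' {π n x} ∩ D).ncard := by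
  obtain ⟨d, hd, hdx⟩ := h.meets_left' n x
  exact (Set.ncard_pos (h.finite_inter_left n x)).2 ⟨d, hdx, hd⟩

theorem ncard_pos_right (n : ℕ) (y : Y) : 0 < (σ n ⁻¹' {σ n y} ∩ D').ncard := by
  obtain ⟨d, hd, hdx⟩ := h.meets_right' n y
  exact (Set.ncard_pos (h.finite_inter_right n y)).2 ⟨d, hdx, hd⟩

/-- One level down at the nonnegative levels: first the fibres of `π k` are distributed over
fibres of `σ (k + 1)`, then the fibres of `σ k` over fibres of `π k`. -/
theorem exists_refinement_of_nat (k : ℕ) {p : Set X × Set Y}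
    (hp : IsGoodPair π σ D D' (k + 1 : ℕ) p) {x₀ : X} {y₀ : Y} (hx₀ : x₀ ∈ p.1) (hy₀ : y₀ ∈ p.2) :
    ∃ 𝒮, IsPointedMatching (IsGoodPair π σ D D' k) 𝒮 p.1 p.2 x₀ y₀ := by
  obtain ⟨A, B⟩ := p
  obtain ⟨⟨xA, rfl : A = _⟩, hBs, -, ⟨yB, hByB⟩, hr⟩ := hp
  obtain ⟨hr1, hr2⟩ := hr (k + 1) rfl
  set A := π (k + 1 : ℕ) ⁻¹' {π (k + 1 : ℕ) xA} with hA
  simp only at hx₀ hy₀ hBs hByB hr1 hr2 ⊢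
  set e : ℝ := (2⁻¹ : ℝ) ^ k with he
  have he0 : 0 < e := by positivity
  have he1 : e ≤ 1 := pow_le_one₀ (by norm_num) (by norm_num)
  have he2 : e * 2 ^ k = 1 := by rw [he, ← mul_pow]; norm_num
  have he' : (2⁻¹ : ℝ) ^ (k + 1) = e / 2 := by rw [pow_succ]; ring
  rw [he'] at hr1 hr2
  have hAs : Saturated (π k) A := h.saturated_left (by push_cast; linarith) xA
  have hAf : (A ∩ D).Finite := h.finite_inter_left (k + 1) xA
  have hBf : (B ∩ D').Finite := (h.finite_inter_right (k + 2) yB).subset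
    (Set.inter_subset_inter_left _ (by convert hByB using 2 <;> push_cast <;> ring_nf))
  have hApos : 0 < ((A ∩ D).ncard : ℝ) := by exact_mod_cast h.ncard_pos_left (k + 1) xA
  have hBpos : 0 < ((B ∩ D').ncard : ℝ) := by
    have : 0 < (1 + e / 2) * ((B ∩ D').ncard : ℝ) := hApos.trans_le hr2
    exact (pos_iff_pos_of_mul_pos this).1 (by positivity)
  have hw : ∀ y, 32 * (u k : ℝ) ≤ e * (σ (k + 1 : ℕ) ⁻¹' {σ (k + 1 : ℕ) y} ∩ D').ncard := by
    intro y
    have h1 : ((32 * 2 ^ k * u k : ℕ) : ℝ) ≤ _ := Nat.cast_le.2 (h.le_ncard_right k y)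
    push_cast at h1
    have h2 := mul_le_mul_of_nonneg_left h1 he0.le
    push_cast
    calc 32 * (u k : ℝ) = e * (32 * 2 ^ k * u k) := by linear_combination (-32 * (u k : ℝ)) * he2
      _ ≤ _ := h2
  have hw' : ∀ x, 32 * (v k : ℝ) ≤ e * (π k ⁻¹' {π k x} ∩ D).ncard := by
    intro x
    have h1 : ((32 * 2 ^ k * v k : ℕ) : ℝ) ≤ _ := Nat.cast_le.2 (h.le_ncard_left k x)
    push_cast at h1
    have h2 := mul_le_mul_of_nonneg_left h1 he0.le
    calc 32 * (v k : ℝ) = e * (32 * 2 ^ k * v k) := by linear_combination (-32 * (v k : ℝ)) * he2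
      _ ≤ _ := h2
  obtain ⟨𝒮, h𝒮⟩ := exists_matching_of_weights (π := π k) (σ := σ (k + 1 : ℕ)) (m := u k) hAs hBs
    (fun x _ => h.meets_left' k x) (fun y _ => h.meets_right' (k + 1) y) hAf hBf
    (fun x _ => by exact_mod_cast h.ncard_le_left k x) hx₀ hy₀ (by
      intro y _
      have h1 := hw y
      have h2 : (0 : ℝ) < (σ (k + 1 : ℕ) ⁻¹' {σ (k + 1 : ℕ) y} ∩ D').ncard := by
        exact_mod_cast h.ncard_pos_right (k + 1) y
      set w : ℝ := ((σ (k + 1 : ℕ) ⁻¹' {σ (k + 1 : ℕ) y} ∩ D').ncard : ℝ)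
      set a : ℝ := ((A ∩ D).ncard : ℝ)
      set b : ℝ := ((B ∩ D').ncard : ℝ)
      have h3 : b ≤ 2 * a := by nlinarith
      have h4 : 32 * (u k : ℝ) ≤ w := by nlinarith
      have h5 : 2 * (u k : ℝ) * b ≤ 2 * (u k : ℝ) * (2 * a) := by gcongr
      nlinarith [mul_pos hApos h2])
  obtain ⟨𝒬, h𝒬, -⟩ := h𝒮.refine (G' := IsGoodPair π σ D D' k) (by
    rintro ⟨A', B'⟩ ⟨⟨y₁, -, rfl : B' = _⟩, hA'A, hA'ne, hA's, hload⟩ x hx y hy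
    simp only at hA'A hA's hload hx hy ⊢
    set B' := σ (k + 1 : ℕ) ⁻¹' {σ (k + 1 : ℕ) y₁} with hB'
    have hA'f : (A' ∩ D).Finite := hAf.subset (Set.inter_subset_inter_left _ hA'A)
    have hB'pos : (0 : ℝ) < (B' ∩ D').ncard := by exact_mod_cast h.ncard_pos_right (k + 1) y₁
    -- the admissible factor grows from `1 + e / 2` through `1 + 3 / 4 * e` to `1 + e`
    obtain ⟨hq1, hq2⟩ := ratio_bounds (c := 1 + e / 2) (c' := 1 + 3 / 4 * e) hApos hBpos hr2 hr1
      hB'pos (by linarith) (by linarith) (by linarith) (by linarith [hw y₁]) hload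
    have hA'pos : (0 : ℝ) < (A' ∩ D).ncard :=
      (pos_iff_pos_of_mul_pos (hB'pos.trans_le hq2)).1 (by positivity)
    obtain ⟨𝒯, h𝒯⟩ := exists_matching_of_weights (π := σ k) (σ := π k) (m := v k) (D := D')
      (D' := D) (A := B') (B := A')
      (h.saturated_right (by push_cast; linarith) y₁) hA's (fun y _ => h.meets_right' k y)
      (fun x _ => h.meets_left' k x) (h.finite_inter_right (k + 1) y₁) hA'f
      (fun y _ => by exact_mod_cast h.ncard_le_right k y) hy hx (by
        intro z _
        have h1 := hw' z
        have h2 : (0 : ℝ) < (π k ⁻¹' {π k z} ∩ D).ncard := by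
          exact_mod_cast h.ncard_pos_left k z
        set w : ℝ := ((π k ⁻¹' {π k z} ∩ D).ncard : ℝ)
        set a : ℝ := ((A' ∩ D).ncard : ℝ)
        set b : ℝ := ((B' ∩ D').ncard : ℝ)
        have h3 : a ≤ 2 * b := by nlinarith
        have h4 : 32 * (v k : ℝ) ≤ w := by nlinarith
        have h5 : 2 * (v k : ℝ) * a ≤ 2 * (v k : ℝ) * (2 * b) := by gcongr
        nlinarith [mul_pos hB'pos h2])
    refine ⟨_, h𝒯.swap.imp ?_⟩
    rintro ⟨A'', B''⟩ ⟨⟨x₁, -, rfl : A'' = _⟩, hBB, hBne, hBs', hload'⟩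
    simp only [Prod.swap_prod_mk] at hBB hBne hBs' hload'
    refine ⟨⟨x₁, rfl⟩, hBs', hBne, ⟨y₁, ?_⟩, ?_⟩
    · convert hBB using 2 <;> push_cast <;> rfl
    · intro k' hk'
      obtain rfl : k = k' := by exact_mod_cast hk'
      exact ratio_bounds (c := 1 + 3 / 4 * e) (c' := 1 + e) hB'pos hA'pos hq2 hq1
        (by exact_mod_cast h.ncard_pos_left k x₁) (by linarith) (by linarith) (by linarith)
        (by linarith [hw' x₁]) hload')
  exact ⟨𝒬, h𝒬⟩

/-- One level down at the negative levels. -/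
theorem exists_refinement_of_neg {n : ℤ} (hn : n < 0) {p : Set X × Set Y}
    (hp : IsGoodPair π σ D D' (n + 1) p) {x₀ : X} {y₀ : Y} (hx₀ : x₀ ∈ p.1) (hy₀ : y₀ ∈ p.2) :
    ∃ 𝒮, IsPointedMatching (IsGoodPair π σ D D' n) 𝒮 p.1 p.2 x₀ y₀ := by
  obtain ⟨A, B⟩ := p
  obtain ⟨⟨xA, rfl : A = _⟩, hBs, -, ⟨yB, hByB⟩, -⟩ := hp
  simp only at hx₀ hy₀ hBs hByB ⊢
  rw [add_assoc, one_add_one_eq_two] at hByB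
  have himg : σ (n + 1) '' B ⊆ σ (n + 1) '' (σ (n + 2) ⁻¹' {σ (n + 2) yB}) := Set.image_mono hByB
  obtain ⟨𝒮, h𝒮⟩ := exists_matching_of_card (h.saturated_left (by linarith) xA) hBs
    (h.finite_left n (n + 1) xA) ((h.finite_right (n + 1) (n + 2) yB).subset himg) hx₀ hy₀
    ((Nat.mul_le_mul_left 3 (Set.ncard_le_ncard himg (h.finite_right _ _ yB))).trans
      (h.micro_left n hn xA yB))
  obtain ⟨𝒬, h𝒬, -⟩ := h𝒮.refine (G' := IsGoodPair π σ D D' n) (by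
    rintro ⟨A', B'⟩ ⟨⟨y₁, -, rfl : B' = _⟩, hA'A, hA'ne, hA's⟩ x hx y hy
    simp only at hA'A hA's hx hy ⊢
    have himg' := Set.image_mono (f := π n) hA'A
    obtain ⟨𝒯, h𝒯⟩ := exists_matching_of_card (h.saturated_right (by linarith) y₁) hA's
      (h.finite_right n (n + 1) y₁) ((h.finite_left n (n + 1) xA).subset himg') hy hx
      ((Nat.mul_le_mul_left 3 (Set.ncard_le_ncard himg' (h.finite_left _ _ xA))).trans
        (h.micro_right n hn xA y₁))
    refine ⟨_, h𝒯.swap.imp ?_⟩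
    rintro ⟨A'', B''⟩ ⟨⟨x₁, -, rfl : A'' = _⟩, hBB, hBne, hBs'⟩
    exact ⟨⟨x₁, rfl⟩, hBs', hBne, ⟨y₁, hBB⟩, fun k hk => by omega⟩)
  exact ⟨𝒬, h𝒬⟩

theorem exists_refinement (n : ℤ) {p : Set X × Set Y}
    (hp : IsGoodPair π σ D D' (n + 1) p) {x₀ : X} {y₀ : Y} (hx₀ : x₀ ∈ p.1) (hy₀ : y₀ ∈ p.2) :
    ∃ 𝒮, IsPointedMatching (IsGoodPair π σ D D' n) 𝒮 p.1 p.2 x₀ y₀ := by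
  rcases lt_or_ge n 0 with hn | hn
  · exact h.exists_refinement_of_neg hn hp hx₀ hy₀
  · lift n to ℕ using hn
    exact h.exists_refinement_of_nat n (by exact_mod_cast hp) hx₀ hy₀

end Interleaved
end Towers
/-! ### Matching two interleaved towers -/

/-- Dependent choice for a property and a relation that vary with the index. -/
theorem exists_seq_of_step {α : Type*} {P : ℕ → α → Prop} {r : ℕ → α → α → Prop}
    (h0 : ∃ a, P 0 a) (h : ∀ k a, P k a → ∃ b, P (k + 1) b ∧ r k a b) :
    ∃ f : ℕ → α, ∀ k, P k (f k) ∧ r k (f k) (f (k + 1)) := by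
  obtain ⟨a, ha⟩ := h0
  choose! g hg hr using h
  let f : ℕ → α := fun k => Nat.rec a (fun k b => g k b) k
  have hf : ∀ k, P k (f k) := fun k => by
    induction k with
    | zero => exact ha
    | succ k ih => exact hg k _ ih
  exact ⟨f, fun k => ⟨hf k, hr k _ (hf k)⟩⟩

section Limit

variable {X Y ι κ : Type*} {π : ℤ → X → ι} {σ : ℤ → Y → κ} {D : Set X} {D' : Set Y} {u v : ℕ → ℕ}

namespace Interleaved

variable (h : Interleaved π σ D D' u v)
include h

/-- The fibre of `π N` at `x₀` can be matched with a union of fibres of `σ N`: these are chosen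
greedily inside the fibre of `σ (N + 1)` at `y₀`, which has sufficient weight. -/
theorem exists_isGoodPair (N : ℕ) (x₀ : X) (y₀ : Y) :
    ∃ B, y₀ ∈ B ∧ IsGoodPair π σ D D' N (π N ⁻¹' {π N x₀}, B) := by
  classical
  set A := π N ⁻¹' {π N x₀} with hA
  set a : ℝ := ((A ∩ D).ncard : ℝ) with ha
  set C := σ (N + 1 : ℕ) ⁻¹' {σ (N + 1 : ℕ) y₀} with hC
  have hCf : (C ∩ D').Finite := h.finite_inter_right (N + 1) y₀
  have hCs : Saturated (σ N) C := h.saturated_right (by push_cast; linarith) y₀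
  set T := hCf.toFinset with hT
  set w : κ → ℝ := fun l => ((T.filter fun e => σ N e = l).card : ℝ) with hw
  have hle : ∀ y, ((σ N ⁻¹' {σ N y} ∩ D').ncard : ℝ) ≤ v N := fun y =>
    Nat.cast_le.2 (h.ncard_le_right N y)
  have hcard : ∀ S : Finset κ, (((C ∩ (σ N ⁻¹' S)) ∩ D').ncard : ℝ) = ∑ l ∈ S, w l := by
    intro S
    have h1 : (C ∩ (σ N ⁻¹' S)) ∩ D' = ((T.filter fun e => σ N e ∈ S : Finset Y) : Set Y) := by
      ext z
      simp only [Set.mem_inter_iff, Set.mem_preimage, Finset.mem_coe, hT, Finset.mem_filter,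
        Set.Finite.mem_toFinset]
      tauto
    rw [h1, Set.ncard_coe_finset, hw, ← Nat.cast_sum, Finset.card_eq_sum_card_fiberwise
      (f := σ N) (t := S)]
    · refine congrArg _ (Finset.sum_congr rfl fun l hl => congrArg _ ?_)
      ext e
      simp only [Finset.mem_filter]
      constructor
      · rintro ⟨⟨h1, -⟩, h2⟩; exact ⟨h1, h2⟩
      · rintro ⟨h1, h2⟩; exact ⟨⟨h1, h2 ▸ hl⟩, h2⟩
    · intro e he
      exact (Finset.mem_filter.1 he).2
  have hwle : ∀ l, w l ≤ v N := by
    intro l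
    by_cases hl : ∃ y, σ N y = l
    · obtain ⟨y, rfl⟩ := hl
      refine le_trans ?_ (hle y)
      have h1 := hcard {σ N y}
      rw [Finset.sum_singleton] at h1
      rw [← h1, Nat.cast_le]
      exact Set.ncard_le_ncard (fun z hz => ⟨by simpa using hz.1.2, hz.2⟩)
        (h.finite_inter_right N y)
    · have : (T.filter fun e => σ N e = l) = ∅ :=
        Finset.filter_eq_empty_iff.2 fun e _ he => hl ⟨e, he⟩
      simp [hw, this]
  set e : ℝ := (2⁻¹ : ℝ) ^ N with he
  have he0 : 0 < e := by positivity
  have he1 : e ≤ 1 := pow_le_one₀ (by norm_num) (by norm_num)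
  have he2 : e * 2 ^ N = 1 := by rw [he, ← mul_pow]; norm_num
  have hva : 32 * (v N : ℝ) ≤ e * a := by
    have h1 : ((32 * 2 ^ N * v N : ℕ) : ℝ) ≤ a := Nat.cast_le.2 (h.le_ncard_left N x₀)
    push_cast at h1
    have h2 := mul_le_mul_of_nonneg_left h1 he0.le
    calc 32 * (v N : ℝ) = e * (32 * 2 ^ N * v N) := by linear_combination (-32 * (v N : ℝ)) * he2
      _ ≤ _ := h2
  have haC : a ≤ (C ∩ D').ncard := by
    refine Nat.cast_le.2 ((h.ncard_le_left N x₀).trans (le_trans ?_ (h.le_ncard_right N y₀)))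
    have : 1 ≤ 2 ^ N := Nat.one_le_two_pow
    nlinarith
  have hCsum : ((C ∩ D').ncard : ℝ) = ∑ l ∈ T.image (σ N), w l := by
    rw [← hcard, Nat.cast_inj]
    congr 1
    ext z
    simp only [Set.mem_inter_iff, Set.mem_preimage, Finset.mem_coe, Finset.mem_image]
    constructor
    · rintro ⟨h1, h2⟩
      exact ⟨⟨h1, z, by simpa [hT] using ⟨h1, h2⟩, rfl⟩, h2⟩
    · rintro ⟨⟨h1, -⟩, h2⟩; exact ⟨h1, h2⟩
  have ha0 : 0 ≤ a := Nat.cast_nonneg _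
  have hv0 : (0 : ℝ) ≤ v N := Nat.cast_nonneg _
  obtain ⟨S, -, hS1, hS2⟩ := exists_subset_sum_mem_window (T.image (σ N)) w (m := v N) (c := a)
    (fun l _ => hwle l) (by positivity) (by linarith)
  -- the fibre of `y₀` is added to the chosen ones
  have hS' : ∑ l ∈ insert (σ N y₀) S, w l ≤ ∑ l ∈ S, w l + v N := by
    by_cases hy : σ N y₀ ∈ S
    · rw [Finset.insert_eq_of_mem hy]; linarith
    · rw [Finset.sum_insert hy]; linarith [hwle (σ N y₀)]
  have hS'' : ∑ l ∈ S, w l ≤ ∑ l ∈ insert (σ N y₀) S, w l :=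
    Finset.sum_le_sum_of_subset_of_nonneg (Finset.subset_insert _ _)
      fun l _ _ => Nat.cast_nonneg _
  refine ⟨C ∩ σ N ⁻¹' (insert (σ N y₀) S : Finset κ), ?_, ⟨x₀, rfl⟩, ?_, ?_, ⟨y₀, ?_⟩, ?_⟩
  · exact ⟨rfl, by simp⟩
  · rintro z z' hz ⟨hz1, hz2⟩
    refine ⟨hCs z z' hz hz1, ?_⟩
    rw [Set.mem_preimage] at hz2 ⊢
    rwa [← hz]
  · exact ⟨y₀, rfl, by simp⟩
  · exact Set.inter_subset_left
  · intro k hk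
    obtain rfl : N = k := by exact_mod_cast hk
    simp only [hcard]
    rw [← he, ← ha]
    have h1 := mul_nonneg he0.le (ha0.trans (hS1.trans hS''))
    constructor <;> linarith

/-- A matching of the two towers at all levels `n ≤ N`, on the parts of `X` and `Y` that are
linked with the base points at level `N`. -/
theorem exists_relation_below (N : ℕ) (x₀ : X) (y₀ : Y) :
    ∃ R : ℤ → X → Y → Prop, ∀ n : ℤ, n ≤ N →
      (∀ k, n ≤ k → k ≤ N → ∀ x y, R n x y → R k x y) ∧ R n x₀ y₀ ∧
      (∀ x x' y, π n x = π n x' → R n x y → R n x' y) ∧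
      (∀ x y y', σ n y = σ n y' → R n x y → R n x y') ∧
      (∀ x x' y, R n x y → R n x' y → π (n + 1) x = π (n + 1) x') ∧
      (∀ x y y', R n x y → R n x y' → σ (n + 1) y = σ (n + 1) y') ∧
      (∀ x, π N x = π N x₀ → ∃ y, R n x y) ∧ (∀ y, σ N y = σ N y₀ → ∃ x, R n x y) := by
  obtain ⟨B, hy₀, hB⟩ := h.exists_isGoodPair N x₀ y₀
  set A := π N ⁻¹' {π N x₀} with hA
  obtain ⟨f, hf⟩ := exists_seq_of_step (α := Set (Set X × Set Y))
    (P := fun k 𝒮 => IsPointedMatching (IsGoodPair π σ D D' (N - k)) 𝒮 A B x₀ y₀)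
    (r := fun _ 𝒮 𝒬 => ∀ q ∈ 𝒬, ∃ p ∈ 𝒮, q.1 ⊆ p.1 ∧ q.2 ⊆ p.2)
    ⟨{(A, B)}, IsMatching.singleton ⟨x₀, rfl⟩ ⟨y₀, hy₀⟩, ⟨_, rfl, rfl, hy₀⟩, by
      rintro _ rfl; simpa using hB⟩
    (fun k 𝒮 h𝒮 => h𝒮.refine fun p hp x hx y hy => h.exists_refinement _ (by
      convert hp using 1; push_cast; ring) hx hy)
  have hmono : ∀ i j, i ≤ j → ∀ q ∈ f j, ∃ p ∈ f i, q.1 ⊆ p.1 ∧ q.2 ⊆ p.2 := by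
    intro i j hij
    induction j, hij using Nat.le_induction with
    | base => exact fun q hq => ⟨q, hq, subset_rfl, subset_rfl⟩
    | succ j _ ih =>
      intro q hq
      obtain ⟨p, hp, h1, h2⟩ := (hf j).2 q hq
      obtain ⟨p', hp', h3, h4⟩ := ih p hp
      exact ⟨p', hp', h1.trans h3, h2.trans h4⟩
  have hyB : ∀ y, σ N y = σ N y₀ → y ∈ B := fun y hy => hB.2.1 _ _ hy.symm hy₀
  refine ⟨fun n x y => ∃ q ∈ f (N - n).toNat, x ∈ q.1 ∧ y ∈ q.2, fun n hn => ?_⟩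
  have hn' : (N : ℤ) - (N - n).toNat = n := by omega
  obtain ⟨⟨hm, hbase, hgood⟩, -⟩ := hf (N - n).toNat
  rw [hn'] at hgood
  refine ⟨?_, hbase, ?_, ?_, ?_, ?_, ?_, ?_⟩
  · rintro k hnk hkN x y ⟨q, hq, hx, hy⟩
    obtain ⟨p, hp, h1, h2⟩ := hmono (N - k).toNat (N - n).toNat (by omega) q hq
    exact ⟨p, hp, h1 hx, h2 hy⟩
  · rintro x x' y hxx ⟨q, hq, hx, hy⟩
    refine ⟨q, hq, ?_, hy⟩
    obtain ⟨⟨z, hz⟩, -⟩ := hgood q hq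
    rw [hz] at hx ⊢
    exact hxx.symm.trans hx
  · rintro x y y' hyy ⟨q, hq, hx, hy⟩
    exact ⟨q, hq, hx, (hgood q hq).2.1 y y' hyy hy⟩
  · rintro x x' y ⟨q, hq, hx, hy⟩ ⟨q', hq', hx', hy'⟩
    obtain rfl := hm.unique_right q hq q' hq' y hy hy'
    obtain ⟨⟨z, hz⟩, -⟩ := hgood q hq
    rw [hz] at hx hx'
    exact h.mono_left n (n + 1) (by linarith) _ _ (Eq.trans hx (Eq.symm hx'))
  · rintro x y y' ⟨q, hq, hx, hy⟩ ⟨q', hq', hx', hy'⟩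
    obtain rfl := hm.unique_left q hq q' hq' x hx hx'
    obtain ⟨z, hz⟩ := (hgood q hq).2.2.2.1
    exact Eq.trans (hz hy) (Eq.symm (hz hy'))
  · intro x hx
    obtain ⟨q, hq, hxq⟩ := hm.exists_left x hx
    obtain ⟨y, hy⟩ := hm.nonempty_right q hq
    exact ⟨y, q, hq, hxq, hy⟩
  · intro y hy
    obtain ⟨q, hq, hyq⟩ := hm.exists_right y (hyB y hy)
    obtain ⟨x, hx⟩ := hm.nonempty_left q hq
    exact ⟨x, q, hq, hx, hyq⟩

/-- A matching of the two towers at all levels, obtained from the matchings below the levels `N`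
as a limit along an ultrafilter. The limit relations are total since the base points stay
matched: the partners of a given point are confined to finitely many fibres at every level. -/
theorem exists_relation (x₀ : X) (y₀ : Y) :
    ∃ R : ℤ → X → Y → Prop, ∀ n : ℤ, (∀ k, n ≤ k → ∀ x y, R n x y → R k x y) ∧
      (∀ x x' y, π n x = π n x' → R n x y → R n x' y) ∧
      (∀ x y y', σ n y = σ n y' → R n x y → R n x y') ∧
      (∀ x x' y, R n x y → R n x' y → π (n + 1) x = π (n + 1) x') ∧
      (∀ x y y', R n x y → R n x y' → σ (n + 1) y = σ (n + 1) y') ∧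
      (∀ x, ∃ y, R n x y) ∧ (∀ y, ∃ x, R n x y) := by
  choose R hR using fun N => h.exists_relation_below N x₀ y₀
  set U := hyperfilter ℕ with hU
  have hge : ∀ n : ℤ, ∀ᶠ N : ℕ in U, n ≤ N := by
    intro n
    refine Nat.hyperfilter_le_atTop ?_
    filter_upwards [eventually_ge_atTop n.toNat] with N hN
    omega
  refine ⟨fun n x y => ∀ᶠ N in U, R N n x y, fun n => ⟨?_, ?_, ?_, ?_, ?_, ?_, ?_⟩⟩
  · intro k hnk x y hxy
    filter_upwards [hxy, hge k] with N h1 h2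
    exact (hR N n (hnk.trans h2)).1 k hnk h2 x y h1
  · intro x x' y hxx hxy
    filter_upwards [hxy, hge n] with N h1 h2
    exact (hR N n h2).2.2.1 x x' y hxx h1
  · intro x y y' hyy hxy
    filter_upwards [hxy, hge n] with N h1 h2
    exact (hR N n h2).2.2.2.1 x y y' hyy h1
  · intro x x' y h1 h2
    obtain ⟨N, h1, h2, h3⟩ := (h1.and (h2.and (hge n))).exists
    exact (hR N n h3).2.2.2.2.1 x x' y h1 h2
  · intro x y y' h1 h2
    obtain ⟨N, h1, h2, h3⟩ := (h1.and (h2.and (hge n))).exists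
    exact (hR N n h3).2.2.2.2.2.1 x y y' h1 h2
  · intro x
    obtain ⟨i, hi⟩ := h.exhaust_left x x₀
    set k : ℤ := max n i with hk
    have hxk : π k x = π k x₀ := h.mono_left i k (le_max_right _ _) _ _ hi
    have hev : ∀ᶠ N in U, ∃ l ∈ σ n '' (σ (k + 1) ⁻¹' {σ (k + 1) y₀}), ∃ y, σ n y = l ∧
        R N n x y := by
      filter_upwards [hge k] with N hN
      have hnN : n ≤ N := (le_max_left _ _).trans hN
      obtain ⟨hmono, -, -, -, -, -, hex, -⟩ := hR N n hnN
      obtain ⟨-, hb, hs, -, -, hu, -⟩ := hR N k hN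
      obtain ⟨y, hy⟩ := hex x (h.mono_left k N hN _ _ hxk)
      refine ⟨σ n y, ⟨y, ?_, rfl⟩, y, rfl, hy⟩
      exact hu x₀ y y₀ (hs x x₀ y hxk (hmono k (le_max_left _ _) hN x y hy)) hb
    rw [Ultrafilter.eventually_exists_mem_iff (h.finite_right _ _ _)] at hev
    obtain ⟨_, ⟨y, -, rfl⟩, hev⟩ := hev
    refine ⟨y, ?_⟩
    filter_upwards [hev, hge n] with N h1 h2
    obtain ⟨y', hy', h3⟩ := h1
    exact (hR N n h2).2.2.2.1 x y' y hy' h3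
  · intro y
    obtain ⟨i, hi⟩ := h.exhaust_right y y₀
    set k : ℤ := max n i with hk
    have hyk : σ k y = σ k y₀ := h.mono_right i k (le_max_right _ _) _ _ hi
    have hev : ∀ᶠ N in U, ∃ l ∈ π n '' (π (k + 1) ⁻¹' {π (k + 1) x₀}), ∃ x, π n x = l ∧
        R N n x y := by
      filter_upwards [hge k] with N hN
      have hnN : n ≤ N := (le_max_left _ _).trans hN
      obtain ⟨hmono, -, -, -, -, -, -, hex⟩ := hR N n hnN
      obtain ⟨-, hb, -, hs, hu, -, -⟩ := hR N k hN
      obtain ⟨x, hx⟩ := hex y (h.mono_right k N hN _ _ hyk)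
      refine ⟨π n x, ⟨x, ?_, rfl⟩, x, rfl, hx⟩
      exact hu x x₀ y₀ (hs x y y₀ hyk (hmono k (le_max_left _ _) hN x y hx)) hb
    rw [Ultrafilter.eventually_exists_mem_iff (h.finite_left _ _ _)] at hev
    obtain ⟨_, ⟨x, -, rfl⟩, hev⟩ := hev
    refine ⟨x, ?_⟩
    filter_upwards [hev, hge n] with N h1 h2
    obtain ⟨x', hx', h3⟩ := h1
    exact (hR N n h2).2.2.1 x' x y hx' h3

end Interleaved
end Limit
/-! ### Components and oscillations -/

section ComponentLemmas

variable {X : Type*} [MetricSpace X]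

theorem mem_component_self (s : ℝ) (x : X) : x ∈ component s x := Relation.ReflTransGen.refl

theorem mem_component_symm {s : ℝ} {x y : X} (h : y ∈ component s x) : x ∈ component s y := by
  have : Std.Symm fun a b : X => dist a b ≤ s := ⟨fun a b hab => by rwa [dist_comm]⟩
  exact (Relation.ReflTransGen.stdSymm (r := fun a b : X => dist a b ≤ s)).symm _ _ h

theorem component_eq_iff {s : ℝ} {x y : X} : component s x = component s y ↔ x ∈ component s y :=
  ⟨fun h => h ▸ mem_component_self s x, fun h => Set.ext fun _ =>
    ⟨fun hz => Relation.ReflTransGen.trans hz h,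
      fun hz => Relation.ReflTransGen.trans hz (mem_component_symm h)⟩⟩

theorem component_mono {s t : ℝ} (hst : s ≤ t) (x : X) : component s x ⊆ component t x :=
  fun y hy => Relation.ReflTransGen.mono
    (r := fun a b : X => dist a b ≤ s) (p := fun a b : X => dist a b ≤ t)
    (fun _ _ hab => le_trans hab hst) y x hy

theorem component_eq_of_le {s t : ℝ} (hst : s ≤ t) {x y : X} (h : component s x = component s y) :
    component t x = component t y :=
  component_eq_iff.2 (component_mono hst y (component_eq_iff.1 h))

theorem mem_component_of_dist_le {s : ℝ} {x y : X} (h : dist y x ≤ s) : y ∈ component s x :=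
  Relation.ReflTransGen.single h

theorem preimage_component (s : ℝ) (x : X) : component s ⁻¹' {component s x} = component s x :=
  Set.ext fun _ => component_eq_iff

theorem mesh_components_le_iff {δ ε : ℝ} (hε : 0 ≤ ε) :
    mesh (components X δ) ≤ ENNReal.ofReal ε ↔ ∀ x y : X, y ∈ component δ x → dist y x ≤ ε := by
  simp only [mesh, components, iSup_le_iff, Set.forall_mem_range, Metric.ediam_le_iff,
    ← edist_le_ofReal hε]
  constructor
  · intro h x y hy
    exact h x y hy x (mem_component_self δ x)
  · intro h z x hx y hy
    exact h y x (Relation.ReflTransGen.trans hx (mem_component_symm hy))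

theorem le_oscillation_iff {Y : Type*} [MetricSpace Y] {f : X → Y} {δ ε : ℝ} (hε : 0 ≤ ε) :
    oscillation f δ ≤ ENNReal.ofReal ε ↔ ∀ x x' : X, dist x x' ≤ δ → dist (f x) (f x') ≤ ε := by
  simp only [oscillation, iSup_le_iff, edist_le_ofReal hε]

end ComponentLemmas

/-- The four conditions of the characterization, with all suprema, infima and limits written
out. -/
structure IsBiCubeLike (X : Type*) [MetricSpace X] : Prop where
  complete : CompleteSpace X
  fine : ∀ ε : ℝ, 0 < ε → ∃ δ : ℝ, 0 < δ ∧ ∀ x y : X, y ∈ component δ x → dist y x ≤ ε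
  coarse : ∀ δ : ℝ, 0 < δ → ∃ ε : ℝ, 0 < ε ∧ ∀ x y : X, y ∈ component δ x → dist y x ≤ ε
  upper : ∀ δ ε : ℝ, 0 < δ → δ ≤ ε → ∃ N : ℕ, ∀ x : X, componentCount δ ε x ≤ N
  large : ∀ δ : ℝ, 0 < δ → ∀ N : ℕ, ∃ ε₀ : ℝ, ∀ ε, ε₀ ≤ ε → ∀ x : X, N ≤ componentCount δ ε x
  small : ∀ ε : ℝ, 0 < ε → ∀ N : ℕ, ∃ δ₀ : ℝ, 0 < δ₀ ∧ ∀ δ, 0 < δ → δ ≤ δ₀ →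
    ∀ x : X, N ≤ componentCount δ ε x

theorem isBiCubeLike_iff (X : Type*) [MetricSpace X] [Nonempty X] :
    IsBiCubeLike X ↔ (CompleteSpace X ∧ BiUniformDimZero X) ∧
      (∀ δ ε : ℝ, 0 < δ → δ ≤ ε → upperTheta X δ ε < ⊤) ∧
      (∀ δ : ℝ, 0 < δ → Tendsto (fun ε : ℝ => lowerTheta X δ ε) atTop (𝓝 (⊤ : ℕ∞))) ∧
      (∀ ε : ℝ, 0 < ε → Tendsto (fun δ : ℝ => lowerTheta X δ ε) (𝓝[>] 0) (𝓝 (⊤ : ℕ∞))) := by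
  have hfine : (∀ ε : ℝ, 0 < ε → ∃ δ : ℝ, 0 < δ ∧ ∀ x y : X, y ∈ component δ x → dist y x ≤ ε) ↔
      MicroUniformDimZero X :=
    forall₂_congr fun ε hε => exists_congr fun δ => and_congr_right fun _ =>
      (mesh_components_le_iff hε.le).symm
  have hcoarse : (∀ δ : ℝ, 0 < δ → ∃ ε : ℝ, 0 < ε ∧ ∀ x y : X, y ∈ component δ x → dist y x ≤ ε) ↔
      MacroUniformDimZero X :=
    forall₂_congr fun δ _ => exists_congr fun ε => and_congr_right fun hε =>
      (mesh_components_le_iff hε.le).symm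
  have hupper : (∀ δ ε : ℝ, 0 < δ → δ ≤ ε → ∃ N : ℕ, ∀ x : X, componentCount δ ε x ≤ N) ↔
      ∀ δ ε : ℝ, 0 < δ → δ ≤ ε → upperTheta X δ ε < ⊤ := by
    refine forall₄_congr fun δ ε _ _ => ?_
    rw [lt_top_iff_ne_top, ENat.ne_top_iff_exists]
    constructor
    · rintro ⟨N, hN⟩
      have : upperTheta X δ ε ≤ N := iSup_le hN
      exact ENat.ne_top_iff_exists.1 (ne_top_of_le_ne_top (ENat.natCast_ne_top N) this)
    · rintro ⟨N, hN⟩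
      exact ⟨N, fun x => hN ▸ le_iSup (fun x : X => componentCount δ ε x) x⟩
  have hlarge : (∀ δ : ℝ, 0 < δ → ∀ N : ℕ, ∃ ε₀ : ℝ, ∀ ε, ε₀ ≤ ε → ∀ x : X,
      N ≤ componentCount δ ε x) ↔
      ∀ δ : ℝ, 0 < δ → Tendsto (fun ε : ℝ => lowerTheta X δ ε) atTop (𝓝 (⊤ : ℕ∞)) := by
    refine forall₂_congr fun δ _ => ?_
    simp only [ENat.tendsto_nhds_top_iff_natCast_lt, eventually_atTop]
    constructor
    · intro h N
      obtain ⟨ε₀, h⟩ := h (N + 1)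
      refine ⟨ε₀, fun ε hε => lt_of_lt_of_le ?_ (le_iInf (h ε hε))⟩
      exact_mod_cast Nat.lt_succ_self N
    · intro h N
      obtain ⟨ε₀, h⟩ := h N
      exact ⟨ε₀, fun ε hε x => (h ε hε).le.trans (iInf_le _ x)⟩
  have hsmall : (∀ ε : ℝ, 0 < ε → ∀ N : ℕ, ∃ δ₀ : ℝ, 0 < δ₀ ∧ ∀ δ, 0 < δ → δ ≤ δ₀ →
      ∀ x : X, N ≤ componentCount δ ε x) ↔
      ∀ ε : ℝ, 0 < ε → Tendsto (fun δ : ℝ => lowerTheta X δ ε) (𝓝[>] 0) (𝓝 (⊤ : ℕ∞)) := by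
    refine forall₂_congr fun ε _ => ?_
    simp only [ENat.tendsto_nhds_top_iff_natCast_lt]
    constructor
    · intro h N
      obtain ⟨δ₀, h0, h⟩ := h (N + 1)
      filter_upwards [Ioc_mem_nhdsGT h0] with δ hδ
      refine lt_of_lt_of_le ?_ (le_iInf (h δ hδ.1 hδ.2))
      exact_mod_cast Nat.lt_succ_self N
    · intro h N
      obtain ⟨δ₀, h0, h⟩ := mem_nhdsGT_iff_exists_Ioc_subset.1 (h N)
      exact ⟨δ₀, h0, fun δ hδ hδ' x => (le_of_lt (h ⟨hδ, hδ'⟩)).trans (iInf_le _ x)⟩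
  rw [← hupper, ← hlarge, ← hsmall, BiUniformDimZero, ← hfine, ← hcoarse]
  exact ⟨fun h => ⟨⟨h.1, h.2, h.3⟩, h.4, h.5, h.6⟩,
    fun ⟨⟨h1, h2, h3⟩, h4, h5, h6⟩ => ⟨h1, h2, h3, h4, h5, h6⟩⟩

/-! ### Invariance under bi-uniform equivalences -/

section Invariance

variable {X Y : Type*} [MetricSpace X] [MetricSpace Y]

theorem map_mem_component {f : X → Y} {δ δ' : ℝ}
    (hf : ∀ x x', dist x x' ≤ δ → dist (f x) (f x') ≤ δ') {x y : X} (h : y ∈ component δ x) :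
    f y ∈ component δ' (f x) :=
  Relation.ReflTransGen.lift (r := fun a b : X => dist a b ≤ δ)
    (p := fun a b : Y => dist a b ≤ δ') f (fun a b => hf a b) y x h

/-- Counting components is monotone under maps that are controlled at the large scale and whose
inverse is controlled at the small scale. -/
theorem componentCount_le (f : X ≃ Y) {δ ε δ' ε' : ℝ}
    (hf : ∀ x x', dist x x' ≤ ε → dist (f x) (f x') ≤ ε')
    (hg : ∀ y y', dist y y' ≤ δ' → dist (f.symm y) (f.symm y') ≤ δ) (x : X) :
    componentCount δ ε x ≤ componentCount δ' ε' (f x) := by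
  have hmaps : ∀ C ∈ component δ '' component ε x,
      ∃ C' ∈ component δ' '' component ε' (f x),
        ∃ z, C = component δ z ∧ C' = component δ' (f z) := by
    rintro _ ⟨z, hz, rfl⟩
    exact ⟨_, ⟨f z, map_mem_component hf hz, rfl⟩, z, rfl, rfl⟩
  choose! F hF hFz using hmaps
  refine Set.encard_le_encard_of_injOn (f := F) hF fun C hC C' hC' h => ?_
  obtain ⟨z, rfl, h1⟩ := hFz C hC
  obtain ⟨z', rfl, h2⟩ := hFz C' hC'
  rw [h1, h2, component_eq_iff] at h
  have h3 := map_mem_component hg h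
  simp only [Equiv.symm_apply_apply] at h3
  exact component_eq_iff.2 h3

theorem MicroUniform.exists_dist_le {f : X → Y} (hf : MicroUniform f) {ε : ℝ} (hε : 0 < ε) :
    ∃ δ, 0 < δ ∧ ∀ x x', dist x x' ≤ δ → dist (f x) (f x') ≤ ε := by
  obtain ⟨δ, hδ, h⟩ := hf ε hε
  exact ⟨δ, hδ, (le_oscillation_iff hε.le).1 h⟩

theorem MacroUniform.exists_dist_le {f : X → Y} (hf : MacroUniform f) {δ : ℝ} (hδ : 0 < δ) :
    ∃ ε, 0 < ε ∧ ∀ x x', dist x x' ≤ δ → dist (f x) (f x') ≤ ε := by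
  obtain ⟨ε, hε, h⟩ := hf δ hδ.le
  exact ⟨ε + 1, by linarith, fun x x' hx => by
    linarith [(le_oscillation_iff hε).1 h x x' hx]⟩

theorem MicroUniform.uniformContinuous {f : X → Y} (hf : MicroUniform f) :
    UniformContinuous f := by
  refine Metric.uniformContinuous_iff.2 fun ε hε => ?_
  obtain ⟨δ, hδ, h⟩ := hf.exists_dist_le (half_pos hε)
  exact ⟨δ, hδ, fun {x y} hxy => (h x y hxy.le).trans_lt (half_lt_self hε)⟩

theorem IsBiCubeLike.of_equiv (hY : IsBiCubeLike Y) (f : X ≃ Y) (hf : BiUniform f)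
    (hg : BiUniform f.symm) : IsBiCubeLike X := by
  refine ⟨?_, ?_, ?_, ?_, ?_, ?_⟩
  · let e : X ≃ᵤ Y := ⟨f, hf.1.uniformContinuous, hg.1.uniformContinuous⟩
    exact e.completeSpace_iff.2 hY.complete
  · intro ε hε
    obtain ⟨ε', hε', h1⟩ := hg.1.exists_dist_le hε
    obtain ⟨δ', hδ', h2⟩ := hY.fine ε' hε'
    obtain ⟨δ, hδ, h3⟩ := hf.1.exists_dist_le hδ'
    exact ⟨δ, hδ, fun x y hy => by simpa using h1 _ _ (h2 _ _ (map_mem_component h3 hy))⟩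
  · intro δ hδ
    obtain ⟨δ', hδ', h3⟩ := hf.2.exists_dist_le hδ
    obtain ⟨ε', hε', h2⟩ := hY.coarse δ' hδ'
    obtain ⟨ε, hε, h1⟩ := hg.2.exists_dist_le hε'
    exact ⟨ε, hε, fun x y hy => by simpa using h1 _ _ (h2 _ _ (map_mem_component h3 hy))⟩
  · intro δ ε hδ hδε
    obtain ⟨ε', hε', h1⟩ := hf.2.exists_dist_le (hδ.trans_le hδε)
    obtain ⟨δ', hδ', h2⟩ := hg.1.exists_dist_le hδ
    obtain ⟨N, hN⟩ := hY.upper (min δ' ε') ε' (lt_min hδ' hε') (min_le_right _ _)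
    exact ⟨N, fun x => (componentCount_le f h1
      (fun y y' h => h2 y y' (h.trans (min_le_left _ _))) x).trans (hN _)⟩
  · intro δ hδ N
    obtain ⟨δ', hδ', h1⟩ := hf.2.exists_dist_le hδ
    obtain ⟨ε₀, h2⟩ := hY.large δ' hδ' N
    obtain ⟨ε, hε, h3⟩ := hg.2.exists_dist_le (lt_max_of_lt_right one_pos : 0 < max ε₀ 1)
    refine ⟨ε, fun ε₁ hε₁ x => (h2 _ (le_max_left _ 1) (f x)).trans ?_⟩
    simpa using componentCount_le f.symm (fun y y' h => (h3 y y' h).trans hε₁)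
      (by simpa using h1) (f x)
  · intro ε hε N
    obtain ⟨ε', hε', h1⟩ := hg.1.exists_dist_le hε
    obtain ⟨δ', hδ', h2⟩ := hY.small ε' hε' N
    obtain ⟨δ, hδ, h3⟩ := hf.1.exists_dist_le hδ'
    refine ⟨δ, hδ, fun δ₁ hδ₁ hδ₁' x => (h2 δ' hδ' le_rfl (f x)).trans ?_⟩
    simpa using componentCount_le f.symm h1
      (by simpa using fun x x' h => h3 x x' (le_trans h hδ₁')) (f x)

end Invariance
/-! ### The bi-cube has the four properties -/

namespace CantorBiCube

theorem dist_le_iff {x y : CantorBiCube} {s : ℝ} (hs : 0 ≤ s) :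
    dist x y ≤ s ↔ ∀ i : ℤ, s < (2 : ℝ) ^ i → x.1 i = y.1 i := by
  constructor
  · intro h i hi
    by_contra hne
    have := term_le_dist x y i
    rw [term_of_ne hne] at this
    linarith
  · intro h
    obtain ⟨i, hi⟩ := (isGreatest_dist x y).1
    rw [← hi]
    by_cases hxy : x.1 i = y.1 i
    · rwa [term_eq_zero hxy]
    · rw [term_of_ne hxy]
      by_contra hlt
      exact hxy (h i (not_le.1 hlt))

/-- The metric is an ultrametric, so chains do not leave balls. -/
theorem mem_component_iff {x y : CantorBiCube} {s : ℝ} (hs : 0 ≤ s) :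
    y ∈ component s x ↔ dist y x ≤ s := by
  refine ⟨fun h => ?_, mem_component_of_dist_le⟩
  refine Relation.ReflTransGen.head_induction_on (motive := fun a _ => dist a x ≤ s) h
    (by rwa [dist_self]) ?_
  intro a c hac _ hc
  exact (dist_le_max a c x).trans (max_le hac hc)

theorem exists_zpow_two_le {s : ℝ} (hs : 0 < s) : ∃ i : ℤ, (2 : ℝ) ^ i ≤ s := by
  obtain ⟨i, hi, -⟩ := exists_mem_Ico_zpow hs (one_lt_two : (1 : ℝ) < 2)
  exact ⟨i, hi⟩

theorem exists_lt_zpow_two (s : ℝ) : ∃ i : ℤ, s < (2 : ℝ) ^ i := by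
  obtain ⟨n, hn⟩ := pow_unbounded_of_one_lt s (one_lt_two : (1 : ℝ) < 2)
  exact ⟨n, by exact_mod_cast hn⟩

theorem zpow_two_le_zpow {i j : ℤ} (h : i ≤ j) : (2 : ℝ) ^ i ≤ 2 ^ j :=
  zpow_le_zpow_right₀ one_le_two h

theorem completeSpace : CompleteSpace CantorBiCube := by
  refine Metric.complete_of_cauchySeq_tendsto fun u hu => ?_
  have hK : ∀ i : ℤ, ∃ K, ∀ m ≥ K, ∀ n ≥ K, ∀ j, i ≤ j → (u m).1 j = (u n).1 j := by
    intro i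
    obtain ⟨K, hK⟩ := Metric.cauchySeq_iff.1 hu ((2 : ℝ) ^ i) (by positivity)
    refine ⟨K, fun m hm n hn j hj => ?_⟩
    exact (dist_le_iff dist_nonneg).1 le_rfl j ((hK m hm n hn).trans_le (zpow_two_le_zpow hj))
  choose K hK using hK
  have hlim : ∀ i, ∀ n ≥ K i, ∀ j, i ≤ j → (u n).1 j = (u (K j)).1 j := by
    intro i n hn j hj
    rw [hK i n hn (max n (K j)) (hn.trans (le_max_left _ _)) j hj,
      hK j (max n (K j)) (le_max_right _ _) (K j) le_rfl j le_rfl]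
  obtain ⟨b, hb⟩ := (u (K 0)).2
  refine ⟨⟨fun j => (u (K j)).1 j, b, fun j hj => ?_⟩, ?_⟩
  · exact (hlim 0 (K 0) le_rfl j (by omega)).symm.trans (hb j hj)
  · refine Metric.tendsto_atTop.2 fun ε hε => ?_
    obtain ⟨i, hi⟩ := exists_zpow_two_le (half_pos hε)
    refine ⟨K i, fun n hn => lt_of_le_of_lt ?_ (half_lt_self hε)⟩
    refine (dist_le_iff (half_pos hε).le).2 fun j hj => hlim i n hn j ?_
    exact ((zpow_lt_zpow_iff_right₀ one_lt_two).1 (hi.trans_lt hj)).le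

/-- The point that differs from `x` exactly at the index `i`. -/
def flip (x : CantorBiCube) (i : ℤ) : CantorBiCube :=
  ⟨Function.update x.1 i (x.1 i + 1), by
    obtain ⟨n, hn⟩ := x.2
    refine ⟨max n i.toNat, fun j hj => ?_⟩
    rw [Function.update_of_ne (by omega)]
    exact hn j (by omega)⟩

theorem flip_apply_self (x : CantorBiCube) (i : ℤ) : (flip x i).1 i ≠ x.1 i := by
  simp only [flip, Function.update_self]
  generalize x.1 i = a
  fin_cases a <;> decide

theorem flip_apply_of_ne (x : CantorBiCube) {i j : ℤ} (h : j ≠ i) : (flip x i).1 j = x.1 j :=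
  Function.update_of_ne h _ _

/-- Flipping a single digit of `x` with index in `[a, a + N)` leads to `N` different
components. -/
theorem le_componentCount {δ ε : ℝ} (hδ : 0 ≤ δ) {a : ℤ} {N : ℕ} (ha : δ < 2 ^ a)
    (haN : (2 : ℝ) ^ (a + N) ≤ ε) (x : CantorBiCube) : N ≤ componentCount δ ε x := by
  have hε : 0 ≤ ε := le_trans (by positivity) haN
  have hinj : Set.InjOn (fun i => component δ (flip x i)) (Finset.Ico a (a + N) : Set ℤ) := by
    intro i hi j hj h
    by_contra hij
    rw [Finset.coe_Ico] at hi
    have h1 := (mem_component_iff hδ).1 (component_eq_iff.1 h)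
    have h2 := (dist_le_iff hδ).1 h1 i (ha.trans_le (zpow_two_le_zpow hi.1))
    rw [flip_apply_of_ne x hij] at h2
    exact flip_apply_self x i h2
  have hcard : (N : ℕ∞) = (Finset.Ico a (a + N) : Set ℤ).encard := by
    rw [Set.encard_coe_eq_coe_finsetCard, Int.card_Ico]
    congr 1
    omega
  rw [hcard, ← hinj.encard_image]
  refine Set.encard_le_encard ?_
  rintro _ ⟨i, hi, rfl⟩
  refine ⟨flip x i, ?_, rfl⟩
  rw [Finset.coe_Ico] at hi
  refine (mem_component_iff hε).2 ((dist_le_iff hε).2 fun j hj => flip_apply_of_ne x ?_)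
  rintro rfl
  exact absurd hj (not_lt.2 ((zpow_two_le_zpow hi.2.le).trans haN))

theorem isBiCubeLike : IsBiCubeLike CantorBiCube := by
  refine ⟨completeSpace, fun ε hε => ⟨ε, hε, fun x y h => (mem_component_iff hε.le).1 h⟩,
    fun δ hδ => ⟨δ, hδ, fun x y h => (mem_component_iff hδ.le).1 h⟩, ?_, ?_, ?_⟩
  · intro δ ε hδ hδε
    have hε : 0 < ε := hδ.trans_le hδε
    obtain ⟨a, ha⟩ := exists_zpow_two_le hδ
    obtain ⟨b, hb⟩ := exists_lt_zpow_two ε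
    -- inside an `ε`-ball the digits with index in `[a, b]` determine the `δ`-component
    refine ⟨Fintype.card (Finset.Icc a b → Fin 2), fun x => ?_⟩
    have hex : ∀ C ∈ component δ '' component ε x, ∃ w : Finset.Icc a b → Fin 2,
        ∃ z ∈ component ε x, C = component δ z ∧
          w = fun i : Finset.Icc a b => z.1 (i : ℤ) := by
      rintro _ ⟨z, hz, rfl⟩
      exact ⟨_, z, hz, rfl, rfl⟩
    choose! F hF using hex
    have hcard : ((Fintype.card (Finset.Icc a b → Fin 2) : ℕ) : ℕ∞)
        = (Set.univ : Set (Finset.Icc a b → Fin 2)).encard := by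
      rw [Set.encard_univ, ENat.card_eq_coe_fintype_card]
    rw [hcard]
    refine Set.encard_le_encard_of_injOn (f := F) (fun _ _ => Set.mem_univ _)
      fun C hC C' hC' h => ?_
    obtain ⟨z, hz, rfl, hw⟩ := hF C hC
    obtain ⟨z', hz', rfl, hw'⟩ := hF C' hC'
    rw [hw, hw'] at h
    rw [component_eq_iff, mem_component_iff hδ.le, dist_le_iff hδ.le]
    intro i hi
    by_cases hib : i ≤ b
    · have hai : a ≤ i := ((zpow_lt_zpow_iff_right₀ one_lt_two).1 (ha.trans_lt hi)).le
      exact congrFun h ⟨i, Finset.mem_Icc.2 ⟨hai, hib⟩⟩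
    · have hi' : ε < (2 : ℝ) ^ i := hb.trans_le (zpow_two_le_zpow (not_le.1 hib).le)
      rw [(dist_le_iff hε.le).1 ((mem_component_iff hε.le).1 hz) i hi',
        (dist_le_iff hε.le).1 ((mem_component_iff hε.le).1 hz') i hi']
  · intro δ hδ N
    obtain ⟨a, ha⟩ := exists_lt_zpow_two δ
    exact ⟨2 ^ (a + N), fun ε hε x => le_componentCount hδ.le ha hε x⟩
  · intro ε hε N
    obtain ⟨b, hb⟩ := exists_zpow_two_le hε
    refine ⟨2 ^ (b - N - 1), by positivity, fun δ hδ hδ' x =>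
      le_componentCount (a := b - N) hδ.le (hδ'.trans_lt ?_) (by simpa using hb) x⟩
    exact (zpow_lt_zpow_iff_right₀ one_lt_two).2 (by omega)

end CantorBiCube
/-! ### Choice of scales -/

section Scales

variable {X Y : Type*} [MetricSpace X] [MetricSpace Y]

/-- Upward choice of scales: each scale is chosen after the previous ones, alternately in `Y` and
in `X`. The numbers `u k` and `v k` bound the weights at level `k`. -/
theorem exists_scales_up (hX : IsBiCubeLike X) (hY : IsBiCubeLike Y) :
    ∃ (a b : ℕ → ℝ) (u v : ℕ → ℕ), ∀ k : ℕ, (k + 1 ≤ a k ∧ k + 1 ≤ b k) ∧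
      (∀ x : X, componentCount 1 (a k) x ≤ u k) ∧ (∀ y : Y, componentCount 1 (b k) y ≤ v k) ∧
      (∀ x : X, (32 * 2 ^ k * v k : ℕ) ≤ componentCount 1 (a k) x) ∧
      a k ≤ a (k + 1) ∧ b k ≤ b (k + 1) ∧
      ∀ y : Y, (32 * 2 ^ k * u k : ℕ) ≤ componentCount 1 (b (k + 1)) y := by
  have hchoose : ∀ (c s : ℝ) (k : ℕ) (v : ℕ), 1 ≤ c → ∃ a u, c ≤ a ∧ s ≤ a ∧
      (∀ x : X, componentCount 1 a x ≤ (u : ℕ)) ∧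
      (∀ x : X, (32 * 2 ^ k * v : ℕ) ≤ componentCount 1 a x) := by
    intro c s k v hc
    obtain ⟨ε, hε⟩ := hX.large 1 one_pos (32 * 2 ^ k * v)
    have h1 : c ≤ max (max c s) ε := (le_max_left _ _).trans (le_max_left _ _)
    obtain ⟨u, hu⟩ := hX.upper 1 (max (max c s) ε) one_pos (hc.trans h1)
    exact ⟨_, u, h1, (le_max_right _ _).trans (le_max_left _ _), hu, hε _ (le_max_right _ _)⟩
  obtain ⟨f, hf⟩ := exists_seq_of_step (α := ℝ × ℝ × ℕ × ℕ)
    (P := fun k s => (k + 1 ≤ s.1 ∧ k + 1 ≤ s.2.1) ∧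
      (∀ x : X, componentCount 1 s.1 x ≤ s.2.2.1) ∧
      (∀ y : Y, componentCount 1 s.2.1 y ≤ s.2.2.2) ∧
      (∀ x : X, (32 * 2 ^ k * s.2.2.2 : ℕ) ≤ componentCount 1 s.1 x))
    (r := fun k s t => s.1 ≤ t.1 ∧ s.2.1 ≤ t.2.1 ∧
      ∀ y : Y, (32 * 2 ^ k * s.2.2.1 : ℕ) ≤ componentCount 1 t.2.1 y) (by
      obtain ⟨v, hv⟩ := hY.upper 1 1 one_pos le_rfl
      obtain ⟨a, u, ha, -, hu, hau⟩ := hchoose 1 1 0 v le_rfl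
      exact ⟨(a, 1, u, v), ⟨by simpa using ha, by simp⟩, hu, hv, hau⟩) (by
      rintro k ⟨a, b, u, v⟩ ⟨⟨ha, hb⟩, -, -, -⟩
      simp only at ha hb
      obtain ⟨ε, hε⟩ := hY.large 1 one_pos (32 * 2 ^ k * u)
      have hk : (0 : ℝ) ≤ k := Nat.cast_nonneg k
      obtain ⟨v', hv'⟩ := hY.upper 1 (max (max b (k + 2)) ε) one_pos
        (le_trans (by linarith) ((le_max_left b _).trans (le_max_left _ _)))
      obtain ⟨a', u', h1, h2, h3, h4⟩ := hchoose a (k + 2) (k + 1) v' (by linarith)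
      refine ⟨(a', max (max b (k + 2)) ε, u', v'), ⟨⟨?_, ?_⟩, h3, hv', h4⟩, h1,
        (le_max_left b _).trans (le_max_left _ _), hε _ (le_max_right _ _)⟩
      · push_cast; linarith
      · have := (le_max_right b (k + 2 : ℝ)).trans (le_max_left _ ε)
        push_cast; linarith)
  exact ⟨fun k => (f k).1, fun k => (f k).2.1, fun k => (f k).2.2.1, fun k => (f k).2.2.2,
    fun k => ⟨(hf k).1.1, (hf k).1.2.1, (hf k).1.2.2.1, (hf k).1.2.2.2, (hf k).2.1, (hf k).2.2.1,
      (hf k).2.2.2⟩⟩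

/-- Downward choice of scales. The number `V` bounds the numbers of pieces at the first scale
in `Y`. -/
theorem exists_scales_down (hX : IsBiCubeLike X) (hY : IsBiCubeLike Y) {a₀ b₀ : ℝ} (ha₀ : 0 < a₀)
    (hb₀ : 0 < b₀) (V : ℕ) :
    ∃ (a b : ℕ → ℝ) (u v : ℕ → ℕ), a 0 = a₀ ∧ b 0 = b₀ ∧ v 0 = V ∧ ∀ k : ℕ,
      ((0 < a k ∧ 0 < b k) ∧ a k ≤ a₀ / (k + 1) ∧ b k ≤ b₀ / (k + 1)) ∧
      a (k + 1) ≤ a k ∧ b (k + 1) ≤ b k ∧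
      (∀ x : X, (3 * v k : ℕ) ≤ componentCount (a (k + 1)) (a k) x) ∧
      (∀ x : X, componentCount (a (k + 1)) (a k) x ≤ u (k + 1)) ∧
      (∀ y : Y, (3 * u (k + 1) : ℕ) ≤ componentCount (b (k + 1)) (b k) y) ∧
      (∀ y : Y, componentCount (b (k + 1)) (b k) y ≤ v (k + 1)) := by
  obtain ⟨f, hf⟩ := exists_seq_of_step (α := ℝ × ℝ × ℕ × ℕ)
    (P := fun k s => (k = 0 → s.1 = a₀ ∧ s.2.1 = b₀ ∧ s.2.2.2 = V) ∧
      (0 < s.1 ∧ 0 < s.2.1) ∧ s.1 ≤ a₀ / (k + 1) ∧ s.2.1 ≤ b₀ / (k + 1))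
    (r := fun k s t => t.1 ≤ s.1 ∧ t.2.1 ≤ s.2.1 ∧
      (∀ x : X, (3 * s.2.2.2 : ℕ) ≤ componentCount t.1 s.1 x) ∧
      (∀ x : X, componentCount t.1 s.1 x ≤ t.2.2.1) ∧
      (∀ y : Y, (3 * t.2.2.1 : ℕ) ≤ componentCount t.2.1 s.2.1 y) ∧
      (∀ y : Y, componentCount t.2.1 s.2.1 y ≤ t.2.2.2))
    ⟨(a₀, b₀, 0, V), by simpa using ⟨ha₀, hb₀⟩⟩ (by
      rintro k ⟨a, b, u, v⟩ ⟨-, ⟨ha, hb⟩, -, -⟩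
      simp only at ha hb
      have hstep : ∀ {s t ε : ℝ}, 0 < s → 0 < t → 0 < ε →
          0 < min (min s t) ε ∧ min (min s t) ε ≤ s ∧ min (min s t) ε ≤ t := fun hs ht hε =>
        ⟨lt_min (lt_min hs ht) hε, (min_le_left _ _).trans (min_le_left _ _),
          (min_le_left _ _).trans (min_le_right _ _)⟩
      have hka : 0 < a₀ / ((k + 1 : ℕ) + 1) := by positivity
      have hkb : 0 < b₀ / ((k + 1 : ℕ) + 1) := by positivity
      obtain ⟨ε, hε, h1⟩ := hX.small a ha (3 * v)
      obtain ⟨h2, h3, h4⟩ := hstep ha hka hε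
      obtain ⟨u', hu'⟩ := hX.upper _ a h2 h3
      obtain ⟨ε', hε', h1'⟩ := hY.small b hb (3 * u')
      obtain ⟨h2', h3', h4'⟩ := hstep hb hkb hε'
      obtain ⟨v', hv'⟩ := hY.upper _ b h2' h3'
      exact ⟨(_, _, u', v'), ⟨fun h => absurd h (Nat.succ_ne_zero k), ⟨h2, h2'⟩, h4, h4'⟩, h3, h3',
        h1 _ h2 (min_le_right _ _), hu', h1' _ h2' (min_le_right _ _), hv'⟩)
  obtain ⟨h1, h2, h3⟩ := (hf 0).1.1 rfl
  exact ⟨fun k => (f k).1, fun k => (f k).2.1, fun k => (f k).2.2.1, fun k => (f k).2.2.2, h1, h2,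
    h3, fun k => ⟨(hf k).1.2, (hf k).2⟩⟩

/-- The sequence on `ℤ` with the values `f k` at `k ≥ 0` and `g k` at `-k < 0`. -/
def glue (f g : ℕ → ℝ) (n : ℤ) : ℝ := if 0 ≤ n then f n.toNat else g (-n).toNat

theorem glue_natCast (f g : ℕ → ℝ) (k : ℕ) : glue f g k = f k := by simp [glue]

theorem glue_neg {f g : ℕ → ℝ} (h : g 0 = f 0) (k : ℕ) : glue f g (-k) = g k := by
  rcases Nat.eq_zero_or_pos k with rfl | hk
  · simp [glue, h]
  · rw [glue, if_neg (by omega), neg_neg, Int.toNat_natCast]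

theorem glue_monotone {f g : ℕ → ℝ} (h : g 0 = f 0) (hf : ∀ k, f k ≤ f (k + 1))
    (hg : ∀ k, g (k + 1) ≤ g k) : Monotone (glue f g) := by
  refine monotone_int_of_le_succ fun n => ?_
  rcases lt_or_ge n 0 with hn | hn
  · obtain ⟨k, rfl⟩ : ∃ k : ℕ, n = -(k + 1 : ℕ) := ⟨(-n - 1).toNat, by omega⟩
    have : -((k + 1 : ℕ) : ℤ) + 1 = -(k : ℕ) := by push_cast; ring
    rw [this, glue_neg h, glue_neg h]
    exact hg k
  · lift n to ℕ using hn
    have : ((n : ℤ) + 1) = (n + 1 : ℕ) := by push_cast; ring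
    rw [this, glue_natCast, glue_natCast]
    exact hf n

theorem exists_div_succ_le {c ε : ℝ} (hε : 0 < ε) : ∃ k : ℕ, c / (k + 1) ≤ ε := by
  obtain ⟨k, hk⟩ := exists_nat_ge (c / ε)
  refine ⟨k, ?_⟩
  rw [div_le_iff₀ (by positivity)]
  rw [div_le_iff₀ hε] at hk
  nlinarith

theorem componentCount_eq (δ ε : ℝ) (x : X) :
    componentCount δ ε x = (component δ '' (component ε ⁻¹' {component ε x})).encard := by
  rw [preimage_component, componentCount]

theorem IsBiCubeLike.finite_image (hX : IsBiCubeLike X) {δ ε : ℝ} (hδ : 0 < δ) (hδε : δ ≤ ε)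
    (x : X) : (component δ '' (component ε ⁻¹' {component ε x})).Finite := by
  obtain ⟨N, hN⟩ := hX.upper δ ε hδ hδε
  have := hN x
  rw [componentCount_eq] at this
  exact Set.finite_of_encard_le_coe this

theorem IsBiCubeLike.cast_ncard (hX : IsBiCubeLike X) {δ ε : ℝ} (hδ : 0 < δ) (hδε : δ ≤ ε)
    (x : X) : (((component δ '' (component ε ⁻¹' {component ε x})).ncard : ℕ) : ℕ∞) =
      componentCount δ ε x := by
  rw [(hX.finite_image hδ hδε x).cast_ncard_eq, componentCount_eq]

/-- Scales along which the components of two spaces form interleaved towers. The sets `D` and `D'`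
are transversals of the components at scale `1`, so that the weight of a component at a larger
scale is a component count. -/
theorem exists_interleaved (hX : IsBiCubeLike X) (hY : IsBiCubeLike Y) :
    ∃ (a b : ℤ → ℝ) (D : Set X) (D' : Set Y) (u v : ℕ → ℕ),
      Interleaved (fun n => component (X := X) (a n)) (fun n => component (X := Y) (b n))
        D D' u v ∧
      (∀ n, 0 < a n ∧ 0 < b n) ∧ (∀ ε, 0 < ε → ∃ n, a n ≤ ε ∧ b n ≤ ε) ∧
      ∀ c, ∃ n, c ≤ a n ∧ c ≤ b n := by
  obtain ⟨a₁, b₁, u, v, h₁⟩ := exists_scales_up hX hY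
  have ha₁ : ∀ k, 1 ≤ a₁ k := fun k => by
    have := (h₁ k).1.1; have : (0 : ℝ) ≤ k := Nat.cast_nonneg k; linarith
  have hb₁ : ∀ k, 1 ≤ b₁ k := fun k => by
    have := (h₁ k).1.2; have : (0 : ℝ) ≤ k := Nat.cast_nonneg k; linarith
  have ha₀ : 0 < a₁ 0 := one_pos.trans_le (ha₁ 0)
  have hb₀ : 0 < b₁ 0 := one_pos.trans_le (hb₁ 0)
  obtain ⟨V, hV⟩ := hY.upper (b₁ 0) (b₁ 1) hb₀ (h₁ 0).2.2.2.2.2.1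
  obtain ⟨a₂, b₂, u₂, v₂, ha₂, hb₂, hv₂, h₂⟩ := exists_scales_down hX hY ha₀ hb₀ V
  set a := glue a₁ a₂ with ha
  set b := glue b₁ b₂ with hb
  have hau : ∀ k : ℕ, a k = a₁ k := glue_natCast _ _
  have hbu : ∀ k : ℕ, b k = b₁ k := glue_natCast _ _
  have had : ∀ k : ℕ, a (-k) = a₂ k := glue_neg ha₂
  have hbd : ∀ k : ℕ, b (-k) = b₂ k := glue_neg hb₂
  have ham : Monotone a := glue_monotone ha₂ (fun k => (h₁ k).2.2.2.2.1) fun k => (h₂ k).2.1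
  have hbm : Monotone b := glue_monotone hb₂ (fun k => (h₁ k).2.2.2.2.2.1) fun k => (h₂ k).2.2.1
  have hpos : ∀ n, 0 < a n ∧ 0 < b n := by
    intro n
    rcases Int.eq_nat_or_neg n with ⟨k, rfl | rfl⟩
    · rw [hau, hbu]; exact ⟨one_pos.trans_le (ha₁ k), one_pos.trans_le (hb₁ k)⟩
    · rw [had, hbd]; exact (h₂ k).1.1
  have hlarge : ∀ c, ∃ n : ℕ, c ≤ a n ∧ c ≤ b n := by
    intro c
    obtain ⟨k, hk⟩ := exists_nat_ge c
    exact ⟨k, by rw [hau]; linarith [(h₁ k).1.1], by rw [hbu]; linarith [(h₁ k).1.2]⟩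
  obtain ⟨D, hD, hDm⟩ := exists_transversal (component (X := X) 1)
  obtain ⟨D', hD', hDm'⟩ := exists_transversal (component (X := Y) 1)
  have hsat : ∀ (k : ℕ) (x : X),
      Saturated (component 1) (component (a k) ⁻¹' {component (a k) x}) :=
    fun k x z z' hz hzx => (component_eq_of_le (by rw [hau]; exact ha₁ k) hz).symm.trans hzx
  have hsat' : ∀ (k : ℕ) (y : Y),
      Saturated (component 1) (component (b k) ⁻¹' {component (b k) y}) :=
    fun k x z z' hz hzx => (component_eq_of_le (by rw [hbu]; exact hb₁ k) hz).symm.trans hzx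
  have hcount : ∀ (k : ℕ) (x : X),
      (((component (a k) ⁻¹' {component (a k) x} ∩ D).ncard : ℕ) : ℕ∞)
        = componentCount 1 (a₁ k) x := fun k x => by
    rw [ncard_inter_transversal hD hDm (hsat k x), hau, hX.cast_ncard one_pos (ha₁ k)]
  have hcount' : ∀ (k : ℕ) (y : Y),
      (((component (b k) ⁻¹' {component (b k) y} ∩ D').ncard : ℕ) : ℕ∞)
        = componentCount 1 (b₁ k) y := fun k y => by
    rw [ncard_inter_transversal hD' hDm' (hsat' k y), hbu, hY.cast_ncard one_pos (hb₁ k)]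
  have hneg : ∀ n : ℤ, n < 0 → ∃ k : ℕ, n = -(k + 1 : ℕ) ∧ n + 1 = -(k : ℕ) :=
    fun n hn => ⟨(-n - 1).toNat, by omega, by omega⟩
  refine ⟨a, b, D, D', u, v, ?_, hpos, ?_, fun c => (hlarge c).imp' _ fun _ => id⟩
  · constructor
    · exact fun m n hmn x x' h => component_eq_of_le (ham hmn) h
    · exact fun m n hmn x x' h => component_eq_of_le (hbm hmn) h
    · intro x x'
      obtain ⟨n, hn, -⟩ := hlarge (dist x x')
      exact ⟨n, component_eq_iff.2 (mem_component_of_dist_le hn)⟩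
    · intro x x'
      obtain ⟨n, -, hn⟩ := hlarge (dist x x')
      exact ⟨n, component_eq_iff.2 (mem_component_of_dist_le hn)⟩
    · intro m n x
      rcases le_total m n with hmn | hmn
      · exact hX.finite_image (hpos m).1 (ham hmn) x
      · refine (Set.finite_singleton (component (a m) x)).subset ?_
        rintro _ ⟨z, hz, rfl⟩
        exact component_eq_of_le (ham hmn) hz
    · intro m n x
      rcases le_total m n with hmn | hmn
      · exact hY.finite_image (hpos m).2 (hbm hmn) x
      · refine (Set.finite_singleton (component (b m) x)).subset ?_
        rintro _ ⟨z, hz, rfl⟩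
        exact component_eq_of_le (hbm hmn) hz
    · intro x
      obtain ⟨d, hd, hdx⟩ := hDm x
      exact ⟨d, hd, component_eq_of_le ((ha₁ 0).trans_eq (hau 0).symm) hdx⟩
    · intro x
      obtain ⟨d, hd, hdx⟩ := hDm' x
      exact ⟨d, hd, component_eq_of_le ((hb₁ 0).trans_eq (hbu 0).symm) hdx⟩
    · intro k x
      refine (bijOn_transversal hD hDm (hsat k x)).finite_iff_finite.2 ?_
      exact hX.finite_image one_pos ((ha₁ k).trans_eq (hau k).symm) x
    · intro k x
      refine (bijOn_transversal hD' hDm' (hsat' k x)).finite_iff_finite.2 ?_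
      exact hY.finite_image one_pos ((hb₁ k).trans_eq (hbu k).symm) x
    · intro k x
      have := (h₁ k).2.1 x
      rw [← hcount] at this
      exact_mod_cast this
    · intro k x
      have := (h₁ k).2.2.1 x
      rw [← hcount'] at this
      exact_mod_cast this
    · intro k x
      have := (h₁ k).2.2.2.1 x
      rw [← hcount] at this
      exact_mod_cast this
    · intro k x
      have := (h₁ k).2.2.2.2.2.2 x
      rw [← hcount'] at this
      exact_mod_cast this
    · intro n hn x y
      obtain ⟨k, h1, h2⟩ := hneg n hn
      have hle : (3 * v₂ k : ℕ) ≤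
          (component (a n) '' (component (a (n + 1)) ⁻¹' {component (a (n + 1)) x})).ncard := by
        have := (h₂ k).2.2.2.1 x
        rw [← had k, ← had (k + 1), ← h1, ← h2, ← hX.cast_ncard (hpos n).1 (ham (by omega))] at this
        exact_mod_cast this
      refine le_trans (Nat.mul_le_mul_left 3 ?_) hle
      rw [← Nat.cast_le (α := ℕ∞), hY.cast_ncard (hpos _).2 (hbm (by omega))]
      -- for `n = -1` the fibres of `σ` are divided between the levels `1` and `0`, where the upward
      -- and the downward choice of scales meet; this is the role of `V`
      rcases Nat.eq_zero_or_pos k with rfl | hk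
      · have h3 : n + 1 = (0 : ℕ) := by omega
        have h4 : n + 2 = (1 : ℕ) := by omega
        rw [h3, h4, hbu, hbu, hv₂]
        exact hV y
      · obtain ⟨j, rfl⟩ := Nat.exists_eq_succ_of_ne_zero hk.ne'
        have h3 : n + 2 = -(j : ℕ) := by omega
        rw [h2, h3, hbd, hbd]
        exact (h₂ j).2.2.2.2.2.2 y
    · intro n hn x y
      obtain ⟨k, h1, h2⟩ := hneg n hn
      have hle : (3 * u₂ (k + 1) : ℕ) ≤
          (component (b n) '' (component (b (n + 1)) ⁻¹' {component (b (n + 1)) y})).ncard := by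
        have := (h₂ k).2.2.2.2.2.1 y
        rw [← hbd k, ← hbd (k + 1), ← h1, ← h2, ← hY.cast_ncard (hpos n).2 (hbm (by omega))] at this
        exact_mod_cast this
      refine le_trans (Nat.mul_le_mul_left 3 ?_) hle
      rw [← Nat.cast_le (α := ℕ∞), hX.cast_ncard (hpos _).1 (ham (by omega)), h1, ← h1, h2, h1,
        had, had]
      exact (h₂ k).2.2.2.2.1 x
  · intro ε hε
    obtain ⟨k, hk⟩ := exists_div_succ_le (c := max (a₁ 0) (b₁ 0)) hε
    have hk0 : (0 : ℝ) < k + 1 := by positivity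
    refine ⟨-(k : ℕ), ?_, ?_⟩
    · rw [had]
      exact ((h₂ k).1.2.1.trans (by gcongr; exact le_max_left _ _)).trans hk
    · rw [hbd]
      exact ((h₂ k).1.2.2.trans (by gcongr; exact le_max_right _ _)).trans hk

end Scales

/-! ### From relations to bi-uniform equivalences -/

section Equivalence

/-- A relation between the points of `X` and `Y` that is total at every level determines a map,
since `Y` is complete and the partners of a point at level `n` lie in one component at scale
`b (n + 1)`. -/
theorem exists_map_of_relation {X Y : Type*} [MetricSpace Y] (hY : IsBiCubeLike Y)
    {b : ℤ → ℝ} (hb : ∀ n, 0 < b n) (hb0 : ∀ ε, 0 < ε → ∃ n, b n ≤ ε) {R : ℤ → X → Y → Prop}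
    (hmono : ∀ n k, n ≤ k → ∀ x y, R n x y → R k x y)
    (hsat : ∀ n x y y', component (b n) y = component (b n) y' → R n x y → R n x y')
    (huniq : ∀ n x y y', R n x y → R n x y' → component (b (n + 1)) y = component (b (n + 1)) y')
    (hex : ∀ n x, ∃ y, R n x y) :
    ∃ f : X → Y, (∀ n x, R n x (f x)) ∧ ∀ x y, (∀ n, R n x y) → y = f x := by
  have hsmall : ∀ ε, 0 < ε → ∃ n, ∀ y y' : Y, component (b (n + 1)) y = component (b (n + 1)) y' →
      dist y y' ≤ ε := by
    intro ε hε
    obtain ⟨δ, hδ, h⟩ := hY.fine ε hε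
    obtain ⟨n, hn⟩ := hb0 δ hδ
    exact ⟨n - 1, fun y y' hyy => h y' y (component_mono hn _ (by
      simpa using component_eq_iff.1 hyy))⟩
  have hpt : ∀ x, ∃ y, ∀ n, R n x y := by
    intro x
    choose z hz using fun k : ℕ => hex (-k) x
    -- partners at the levels `-k` form a Cauchy sequence
    have hcauchy : CauchySeq z := by
      refine Metric.cauchySeq_iff'.2 fun ε hε => ?_
      obtain ⟨n, hn⟩ := hsmall (ε / 2) (half_pos hε)
      refine ⟨(-n).toNat, fun k hk => (hn _ _ (huniq n x _ _ ?_ ?_)).trans_lt (half_lt_self hε)⟩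
      · exact hmono _ _ (by omega) _ _ (hz k)
      · exact hmono _ _ (by omega) _ _ (hz _)
    have := hY.complete
    obtain ⟨y, hy⟩ := cauchySeq_tendsto_of_complete hcauchy
    refine ⟨y, fun n => ?_⟩
    obtain ⟨K, hK⟩ := Metric.tendsto_atTop.1 hy (b n) (hb n)
    have h1 := hK (max K (-n).toNat) (le_max_left _ _)
    refine hsat n x _ y (component_eq_iff.2 (mem_component_of_dist_le h1.le))
      (hmono _ _ ?_ _ _ (hz (max K (-n).toNat)))
    have := le_max_right K (-n).toNat
    omega
  choose f hf using hpt
  refine ⟨f, fun n x => hf x n, fun x y hy => ?_⟩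
  refine dist_le_zero.1 (le_of_forall_pos_le_add fun ε hε => ?_)
  obtain ⟨n, hn⟩ := hsmall ε hε
  rw [zero_add]
  exact hn _ _ (huniq n x _ _ (hy n) (hf x n))

variable {X Y : Type*} [MetricSpace X] [MetricSpace Y]

theorem biUniform_of_component {f : X → Y} (hY : IsBiCubeLike Y) {a b : ℤ → ℝ}
    (ha : ∀ n, 0 < a n) (hb : ∀ n, 0 < b n) (hb0 : ∀ ε, 0 < ε → ∃ n, b n ≤ ε)
    (ha1 : ∀ c, ∃ n, c ≤ a n) (hf : ∀ n x x', dist x x' ≤ a n →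
      component (b (n + 1)) (f x) = component (b (n + 1)) (f x')) : BiUniform f := by
  constructor
  · intro ε hε
    obtain ⟨δ, hδ, h⟩ := hY.fine ε hε
    obtain ⟨n, hn⟩ := hb0 δ hδ
    refine ⟨a (n - 1), ha _, (le_oscillation_iff hε.le).2 fun x x' hx => h _ _ ?_⟩
    have := hf (n - 1) x x' hx
    rw [sub_add_cancel] at this
    exact component_mono hn _ (component_eq_iff.1 this)
  · intro δ _
    obtain ⟨n, hn⟩ := ha1 δ
    obtain ⟨ε, hε, h⟩ := hY.coarse (b (n + 1)) (hb _)
    exact ⟨ε, hε.le, (le_oscillation_iff hε.le).2 fun x x' hx =>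
      h _ _ (component_eq_iff.1 (hf n x x' (hx.trans hn)))⟩

/-- Any two nonempty spaces with the four properties are bi-uniformly equivalent: the matching of
their component towers defines mutually inverse maps in both directions. -/
theorem IsBiCubeLike.biUniformlyEquivalent [Nonempty X] [Nonempty Y] (hX : IsBiCubeLike X)
    (hY : IsBiCubeLike Y) : BiUniformlyEquivalent X Y := by
  obtain ⟨a, b, D, D', u, v, h, hpos, h0, h1⟩ := exists_interleaved hX hY
  obtain ⟨R, hR⟩ := h.exists_relation (Classical.arbitrary X) (Classical.arbitrary Y)
  obtain ⟨f, hf, hfu⟩ := exists_map_of_relation (X := X) hY (fun n => (hpos n).2)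
    (fun ε hε => (h0 ε hε).imp fun _ => And.right) (fun n => (hR n).1)
    (fun n => (hR n).2.2.1) (fun n => (hR n).2.2.2.2.1) (fun n => (hR n).2.2.2.2.2.1)
  obtain ⟨g, hg, hgu⟩ := exists_map_of_relation (X := Y) (R := fun n y x => R n x y) hX
    (fun n => (hpos n).1) (fun ε hε => (h0 ε hε).imp fun _ => And.left)
    (fun n k hnk y x => (hR n).1 k hnk x y) (fun n y x x' => (hR n).2.1 x x' y)
    (fun n y x x' => (hR n).2.2.2.1 x x' y) (fun n => (hR n).2.2.2.2.2.2)
  refine ⟨⟨f, g, fun x => (hgu _ x fun n => hf n x).symm,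
    fun y => (hfu _ y fun n => hg n y).symm⟩, ?_, ?_⟩
  · refine biUniform_of_component hY (fun n => (hpos n).1) (fun n => (hpos n).2)
      (fun ε hε => (h0 ε hε).imp fun _ => And.right) (fun c => (h1 c).imp fun _ => And.left)
      fun n x x' hx => (hR n).2.2.2.2.1 x' _ _ ?_ (hf n x')
    exact (hR n).2.1 x x' _ (component_eq_iff.2 (mem_component_of_dist_le hx)) (hf n x)
  · refine biUniform_of_component hX (fun n => (hpos n).2) (fun n => (hpos n).1)
      (fun ε hε => (h0 ε hε).imp fun _ => And.left) (fun c => (h1 c).imp fun _ => And.right)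
      fun n y y' hy => (hR n).2.2.2.1 _ _ y' ?_ (hg n y')
    exact (hR n).2.2.1 _ y y' (component_eq_iff.2 (mem_component_of_dist_le hy)) (hg n y)

end Equivalence
end BiCube

theorem mainTheorem2 (X : Type*) [MetricSpace X] [Nonempty X] :
    BiCube.BiUniformlyEquivalent X BiCube.CantorBiCube ↔
      (CompleteSpace X ∧ BiCube.BiUniformDimZero X) ∧
      (∀ δ ε : ℝ, 0 < δ → δ ≤ ε → BiCube.upperTheta X δ ε < ⊤) ∧
      (∀ δ : ℝ, 0 < δ →
        Tendsto (fun ε : ℝ => BiCube.lowerTheta X δ ε) atTop (𝓝 (⊤ : ℕ∞))) ∧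
      (∀ ε : ℝ, 0 < ε →
        Tendsto (fun δ : ℝ => BiCube.lowerTheta X δ ε) (𝓝[>] 0) (𝓝 (⊤ : ℕ∞))) := by
  rw [← BiCube.isBiCubeLike_iff]
  constructor
  · rintro ⟨f, hf, hg⟩
    exact BiCube.CantorBiCube.isBiCubeLike.of_equiv f hf hg
  · intro hX
    have : Nonempty BiCube.CantorBiCube := ⟨⟨fun _ => 0, 0, fun _ _ => rfl⟩⟩
    exact hX.biUniformlyEquivalent BiCube.CantorBiCube.isBiCubeLike
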